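/- **Setting.** Fix infinite sets of program variables, heap locations $\ell$, ghost locations $g$ and IDs; infinite well-founded partially ordered sets of levels and of degrees; an infinite well-ordered set of thread IDs; a set of values containing a unit value $\mathsf{tt}$, the Booleans and the heap locations; a set of ghost values; and a set of partial functions on values as operations. A *phase ID* $\iota$ is a finite word over $\{\mathsf{Forker},\mathsf{Forkee}\}$, and $\sqsubseteq$ is the prefix order. A *signal* is a pair $s=(id,L)$ and a *mutex* a pair $m=(\ell,L)$, $L$ being a level; each of them is also an *obligation* of level $L$; an obligation bag $O$ is a multiset of obligations. Write $L\prec O$ if $L$ is below the levels of all elements of $O$. *Commands* are $\mathsf{while}\ c\ \mathsf{do\ skip}$, $\mathsf{fork}\ c$, $\mathsf{let}\ x:=c\ \mathsf{in}\ c'$, $\mathsf{if}\ c\ \mathsf{then}\ c'$, allocation, reading and assignment of heap cells, $\mathsf{new\_mutex}$, $\mathsf{acquire}\ e$, $\mathsf{release}\ e$, expressions, and the intermediate command $\mathsf{consumeItPerm}$. Expressions that have a value are identified with it. *Evaluation contexts* are $E=\mathsf{if}\ \square\ \mathsf{then}\ c$ and $E=\mathsf{let}\ x:=\square\ \mathsf{in}\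 c$. Plain thread pools (finite partial maps from thread IDs to commands or the mark $\mathsf{term}$) with physical heaps (finite sets of chunks $\ell\mapsto v$, $\mathsf{unlocked}(\ell)$, $\mathsf{locked}(\ell)$) reduce in the usual interleaving way. A loop unfolds to $\mathsf{if}\ c\ \mathsf{then\ while}\ c\ \mathsf{do\ skip}$, a forked thread gets the least unused thread ID, and a thread that is a value becomes $\mathsf{term}$. *Assertions* $A$ are built from truth values, $\neg,\wedge,\vee$, set-indexed $\bigvee$, $\ast$, and fractional or full chunks. A *logical heap* is a map from logical resources $\ell\mapsto v$, $g\mapsto w$, $\mathsf{signal}(s,b)$, $\mathsf{uninit}(\ell)$, $\mathsf{mutex}(m,P)$, $\mathsf{locked}(m,P,f)$, $\mathsf{phase}(\iota)$, $\mathsf{obs}(O)$, $\mathsf{wperm}(\iota,id,\delta)$, $\mathsf{itperm}(\iota,\delta)$ to $\mathbb Q_{\ge0}$ ($P$ an assertion, $f\in(0,1]\cap\mathbb Q$, $b$ a Boolean, $\delta$ a degree), and $h\models A$ is the usual satisfaction, with $h\models A\ast B$ iff $h=h_1+h_2$ with $h_1\models A$ and $h_2\models B$. A heap is *complete* if it has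 exactly one phase chunk and exactly one obligations chunk, both with value $1$. An *annotated heap* $\hat h$ is a finite set of chunks $\ell\mapsto v$, $\mathsf{uninit}(\ell)$, $\mathsf{unlocked}(m,P,h_P)$ ($h_P$ a logical heap), $\mathsf{locked}(m,P,f)$, $\mathsf{signal}(s,b)$. An *annotated thread pool* is a finite partial map from thread IDs to pairs $(h,c)$ of a logical heap $h$ (the resources owned by the thread) and a command $c$ or $\mathsf{term}$. *Real annotated steps* of a thread $\theta$ follow the plain steps and update its heap $h$: - allocation and mutex creation at a fresh $\ell$ add the new chunk to both heaps (a new mutex gives $\mathsf{uninit}(\ell)$); reading $\ell$ needs $(\ell\mapsto v)\in\hat h$; assignment to $\ell$ replaces $\ell\mapsto v$ in both heaps; - $\mathsf{fork}\ c$ replaces $\mathsf{phase}(\iota),\mathsf{obs}(O_m\uplus O_f)$ by $\mathsf{phase}(\iota.\mathsf{Forker}),\mathsf{obs}(O_m)$ and starts a thread running $c$ with $\mathsf{phase}(\iota.\mathsf{Forkee}),\mathsf{obs}(O_f)$ and a part of $h$; - $\mathsf{while}\ c\ \mathsf{do\ skip}$ unfolds to $\mathsf{if}\ c\ \mathsf{then}\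 (\mathsf{consumeItPerm};\mathsf{while}\ c\ \mathsf{do\ skip})$; - $\mathsf{consumeItPerm}$ becomes $\mathsf{tt}$ and consumes one $\mathsf{itperm}(\iota',\delta)$, where $\iota'\sqsubseteq\iota$ for the thread's phase $\iota$; - acquiring $m=(\ell,L)$ with $L\prec O$ turns $\mathsf{unlocked}(m,P,h_P)\in\hat h$ into $\mathsf{locked}(m,P,f)$, and $f\cdot\mathsf{mutex}(m,P),\mathsf{obs}(O)$ into $\mathsf{locked}(m,P,f),\mathsf{obs}(O\uplus\{m\})$ plus $h_P$; releasing is the inverse, for any part $h_P\models P$ of the thread's heap without phase and obligations chunks; - a thread that is a value becomes $\mathsf{term}$, keeping its heap, provided that the heap is complete with $\mathsf{obs}(\emptyset)$. *Ghost steps* of a thread $\theta$ that has not terminated leave its command unchanged: - create a signal $s=(id,L)$ with unused $id$: adds $\mathsf{signal}(s,\mathsf{False})$ to both heaps and turns $\mathsf{obs}(O)$ into $\mathsf{obs}(O\uplus\{s\})$; - set $s$: turns $\mathsf{signal}(s,\mathsf{False})$ into $\mathsf{signal}(s,\mathsf{True})$ in both heaps and $\mathsf{obs}(O\uplus\{s\})$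 into $\mathsf{obs}(O)$; - for $\delta'<\delta$, turn $\mathsf{itperm}(\iota,\delta)$ into $\mathsf{wperm}(\iota,id,\delta')$ or into $k$ copies of $\mathsf{itperm}(\iota,\delta')$, $k\in\mathbb N$; - *wait* for $s=(id,L)$: if $\mathsf{signal}(s,\mathsf{False})\in\hat h$, $L\prec O$, and the thread holds $\mathsf{phase}(\iota),\mathsf{obs}(O),\mathsf{wperm}(\iota',id,\delta)$ with $\iota'\sqsubseteq\iota$, it gains $\mathsf{itperm}(\iota,\delta)$; - extend the phase ID of an iteration or wait permission; - initialize a mutex: turn $\mathsf{uninit}(\ell)$ together with a part $h_P\models P$ without phase and obligations chunks into $\mathsf{mutex}((\ell,L),P)$, and $\mathsf{uninit}(\ell)\in\hat h$ into $\mathsf{unlocked}((\ell,L),P,h_P)$; - create (at an unused ghost location) or mutate a ghost cell. An *infinite annotated reduction sequence* is a sequence $(\hat h_i,\hat t_i)_{i\in\mathbb N}$ of annotated heaps and annotated thread pools in which each configuration results from the previous one by a real or ghost step of some thread. (It carries an annotation that records for each $i$ the signal waited for if step $i$ is a wait step, and is undefined otherwise.) It is *fair* if for every $i$ and every thread $\theta$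 of $\hat t_i$ that is not $\mathsf{term}$ there is $k\ge i$ such that $(\hat h_{k+1},\hat t_{k+1})$ results from $(\hat h_k,\hat t_k)$ by a real step of $\theta$. *Safety* of $(h,c)$ is defined coinductively (greatest solution): if $h$ is complete, then for every consistent annotated configuration $(\hat h,\hat t)$ compatible with a physical heap and with a plain pool $t$ (obtained from $\hat t$ by dropping the logical heaps and removing $\mathsf{consumeItPerm}$) such that $\hat t(\theta)=(h,c)$ and $t(\theta)=c$, every plain step of $\theta$ is matched by finitely many ghost steps followed by one real step of $\theta$, leading to an annotated configuration that is again compatible with the resulting plain one and whose newly occurring threads $(h',c')$ are safe. Here a configuration is consistent if the heaps of the threads and of the unlocked mutexes contain phase, obligations and permission chunks only with natural multiplicities and no two chunks for the same location, and the sum of these heaps corresponds chunk by chunk to $\hat h$. Finally $\models\{A\}\,c\,\{r.\,B(r)\}$ means: for every logical heap $h_F$ and evaluation context $E$, if $(h_B+h_F,E[v])$ is safe for all values $v$ and all $h_B\models B(v)$, then $(h_A+h_F,E[c])$ is safe for all $h_A\models A$. **Lemma (No fair infinite annotated reduction sequence).** Let $c$ be a command, $\iota_0$ a phase ID, $N\in\mathbb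 N$ and $\delta_1,\dots,\delta_N$ degrees such that $$\models\Big\{\mathsf{phase}(\iota_0)\ast\mathsf{obs}(\emptyset)\ast\mathop{\ast}_{i=1,\dots,N}\mathsf{itperm}(\iota_0,\delta_i)\Big\}\ c\ \{\mathsf{obs}(\emptyset)\}.$$ Let $\theta_0$ be any thread ID, and let $h_0$ be the logical heap that consists of $\mathsf{phase}(\iota_0),\mathsf{obs}(\emptyset),\mathsf{itperm}(\iota_0,\delta_1),\dots,\mathsf{itperm}(\iota_0,\delta_N)$, where permissions of equal degree are either counted with multiplicity or counted once. Then there is no fair infinite annotated reduction sequence $(\hat h_i,\hat t_i)_{i\in\mathbb N}$ with $\hat h_0=\emptyset$ and $\hat t_0=\{\theta_0\mapsto(h_0,c)\}$. -/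

import Mathlib

universe u v

open scoped NNRat

noncomputable section

namespace GhostSignals

/-! ## Base sets -/

/-- Values: the unit value, the Booleans, the heap locations, and arbitrary further values. -/
inductive Value (HLoc Other : Type u) : Type u
  | unit : Value HLoc Other
  | bool (b : Bool) : Value HLoc Other
  | loc (l : HLoc) : Value HLoc Other
  | other (o : Other) : Value HLoc Other

/-- The base sets over which programs, assertions and heaps are built. `opFun` gives the partial
function on values that an operation symbol denotes (`none` means undefined). -/
structure BaseSets where
  Var : Type u
  HLoc : Type u
  GLoc : Type u
  Level : Type u
  Degree : Type u
  ID : Type u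
  TID : Type u
  OtherVal : Type u
  GVal : Type u
  Op : Type u
  opFun : Op → List (Value HLoc OtherVal) → Option (Value HLoc OtherVal)
  varInfinite : Infinite Var
  hlocInfinite : Infinite HLoc
  glocInfinite : Infinite GLoc
  levelOrder : PartialOrder Level
  levelInfinite : Infinite Level
  levelWF : WellFoundedLT Level
  degreeOrder : PartialOrder Degree
  degreeInfinite : Infinite Degree
  degreeWF : WellFoundedLT Degree
  idInfinite : Infinite ID
  tidOrder : LinearOrder TID
  tidInfinite : Infinite TID
  tidWF : WellFoundedLT TID

attribute [instance] BaseSets.varInfinite BaseSets.hlocInfinite BaseSets.glocInfinite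
  BaseSets.levelOrder BaseSets.levelInfinite BaseSets.levelWF BaseSets.degreeOrder
  BaseSets.degreeInfinite BaseSets.degreeWF BaseSets.idInfinite BaseSets.tidOrder
  BaseSets.tidInfinite BaseSets.tidWF

abbrev Val (U : BaseSets.{u}) : Type u := Value U.HLoc U.OtherVal

instance (U : BaseSets.{u}) : DecidableEq U.Var := Classical.decEq _
instance (U : BaseSets.{u}) : DecidableEq (Val U) := Classical.decEq _

/-! ## Syntax of the programming language -/

inductive Exp (U : BaseSets.{u}) : Type u
  | var (x : U.Var) : Exp U
  | val (w : Val U) : Exp U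
  | eq (e₁ e₂ : Exp U) : Exp U
  | not (e : Exp U) : Exp U
  | op (o : U.Op) (n : ℕ) (args : Fin n → Exp U) : Exp U

inductive Cmd (U : BaseSets.{u}) : Type u
  /-- `while c do skip` -/
  | while (c : Cmd U) : Cmd U
  | fork (c : Cmd U) : Cmd U
  /-- `let x := c₁ in c₂` -/
  | letIn (x : U.Var) (c₁ c₂ : Cmd U) : Cmd U
  /-- `if c₁ then c₂` -/
  | ifThen (c₁ c₂ : Cmd U) : Cmd U
  | alloc (e : Exp U) : Cmd U
  | read (e : Exp U) : Cmd U
  | assign (e₁ e₂ : Exp U) : Cmd U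
  | newMutex : Cmd U
  | acquire (e : Exp U) : Cmd U
  | release (e : Exp U) : Cmd U
  | exp (e : Exp U) : Cmd U
  /-- Intermediate representation, reduced by the annotated semantics only. -/
  | consumeItPerm : Cmd U

section
variable {U : BaseSets.{u}}

/-- Free variables of an expression. -/
def Exp.fv : Exp U → Set U.Var
  | .var x => {x}
  | .val _ => ∅
  | .eq e₁ e₂ => e₁.fv ∪ e₂.fv
  | .not e => e.fv
  | .op _ _ args => ⋃ i, (args i).fv

/-- Free variables of a command. -/
def Cmd.fv : Cmd U → Set U.Var
  | .while c => c.fv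
  | .fork c => c.fv
  | .letIn x c₁ c₂ => c₁.fv ∪ (c₂.fv \ {x})
  | .ifThen c₁ c₂ => c₁.fv ∪ c₂.fv
  | .alloc e => e.fv
  | .read e => e.fv
  | .assign e₁ e₂ => e₁.fv ∪ e₂.fv
  | .newMutex => ∅
  | .acquire e => e.fv
  | .release e => e.fv
  | .exp e => e.fv
  | .consumeItPerm => ∅

/-- Substitution of the value `w` for the variable `x`. -/
def Exp.subst (x : U.Var) (w : Val U) : Exp U → Exp U
  | .var y => if y = x then .val w else .var y
  | .val w' => .val w'
  | .eq e₁ e₂ => .eq (e₁.subst x w) (e₂.subst x w)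
  | .not e => .not (e.subst x w)
  | .op o n args => .op o n fun i => (args i).subst x w

/-- Substitution of the value `w` for the free occurrences of the variable `x`. -/
def Cmd.subst (x : U.Var) (w : Val U) : Cmd U → Cmd U
  | .while c => .while (c.subst x w)
  | .fork c => .fork (c.subst x w)
  | .letIn y c₁ c₂ => .letIn y (c₁.subst x w) (if y = x then c₂ else c₂.subst x w)
  | .ifThen c₁ c₂ => .ifThen (c₁.subst x w) (c₂.subst x w)
  | .alloc e => .alloc (e.subst x w)
  | .read e => .read (e.subst x w)
  | .assign e₁ e₂ => .assign (e₁.subst x w) (e₂.subst x w)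
  | .newMutex => .newMutex
  | .acquire e => .acquire (e.subst x w)
  | .release e => .release (e.subst x w)
  | .exp e => .exp (e.subst x w)
  | .consumeItPerm => .consumeItPerm

/-- Partial evaluation of expressions; `none` means undefined. -/
def Exp.eval : Exp U → Option (Val U)
  | .var _ => none
  | .val w => some w
  | .eq e₁ e₂ =>
    match e₁.eval, e₂.eval with
    | some w₁, some w₂ => some (.bool (decide (w₁ = w₂)))
    | _, _ => none
  | .not e =>
    match e.eval with
    | some (.bool b) => some (.bool (!b))
    | _ => none
  | .op o _ args => ((List.ofFn fun i => (args i).eval).mapM id).bind (U.opFun o)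

/-- The value `w` as a command. -/
abbrev Cmd.ofVal (w : Val U) : Cmd U := .exp (.val w)

/-- The unit value as a command. -/
abbrev Cmd.tt : Cmd U := .ofVal .unit

end

inductive EvalCtxt (U : BaseSets.{u}) : Type u
  /-- `if □ then c` -/
  | ifThen (c : Cmd U) : EvalCtxt U
  /-- `let x := □ in c` -/
  | letIn (x : U.Var) (c : Cmd U) : EvalCtxt U

def EvalCtxt.fill {U : BaseSets.{u}} : EvalCtxt U → Cmd U → Cmd U
  | .ifThen c₂, c => .ifThen c c₂
  | .letIn x c₂, c => .letIn x c c₂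

/-! ## Physical heaps and plain semantics -/

inductive PhysRes (U : BaseSets.{u}) : Type u
  | pointsTo (l : U.HLoc) (w : Val U) : PhysRes U
  | unlocked (l : U.HLoc) : PhysRes U
  | locked (l : U.HLoc) : PhysRes U

instance (U : BaseSets.{u}) : DecidableEq (PhysRes U) := Classical.decEq _

abbrev PhysHeap (U : BaseSets.{u}) : Type u := Finset (PhysRes U)

/-- Allocated heap locations of a physical heap. -/
def PhysHeap.locs {U : BaseSets.{u}} (h : PhysHeap U) : Set U.HLoc :=
  {l | .unlocked l ∈ h ∨ .locked l ∈ h ∨ ∃ w, .pointsTo l w ∈ h}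

/-- `STStep h c h' c' T`: single thread reduction; `T` is the at most one forked thread.
Expressions with a value are identified with this value, so no rule reduces them. In the rules
`h, r ∉ h, insert r h` stands for the disjoint union of `h` and `{r}`. -/
inductive STStep {U : BaseSets.{u}} :
    PhysHeap U → Cmd U → PhysHeap U → Cmd U → Option (Cmd U) → Prop
  | evalCtxt {h c h' c' T} (E : EvalCtxt U) :
      STStep h c h' c' T → STStep h (E.fill c) h' (E.fill c') T
  | fork (h c) : STStep h (.fork c) h .tt (some c)
  | while (h c) : STStep h (.while c) h (.ifThen c (.while c)) none
  | ifTrue (h) {e : Exp U} (c) :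
      e.eval = some (.bool true) → STStep h (.ifThen (.exp e) c) h c none
  | ifFalse (h) {e : Exp U} (c) :
      e.eval = some (.bool false) → STStep h (.ifThen (.exp e) c) h .tt none
  | letIn (h) (x : U.Var) {e : Exp U} {w} (c) :
      e.eval = some w → STStep h (.letIn x (.exp e) c) h (c.subst x w) none
  | alloc {h : PhysHeap U} {e : Exp U} {w l} :
      e.eval = some w → l ∉ h.locs →
      STStep h (.alloc e) (insert (.pointsTo l w) h) (.ofVal (.loc l)) none
  | read {h : PhysHeap U} {e : Exp U} {l w} :
      e.eval = some (.loc l) → .pointsTo l w ∈ h → STStep h (.read e) h (.ofVal w) none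
  | assign {h : PhysHeap U} {e₁ e₂ : Exp U} {l w w'} :
      e₁.eval = some (.loc l) → e₂.eval = some w' → .pointsTo l w ∉ h →
      STStep (insert (.pointsTo l w) h) (.assign e₁ e₂) (insert (.pointsTo l w') h) .tt none
  | newMutex {h : PhysHeap U} {l} :
      l ∉ h.locs → STStep h .newMutex (insert (.unlocked l) h) (.ofVal (.loc l)) none
  | acquire {h : PhysHeap U} {e : Exp U} {l} :
      e.eval = some (.loc l) → .unlocked l ∉ h →
      STStep (insert (.unlocked l) h) (.acquire e) (insert (.locked l) h) .tt none
  | release {h : PhysHeap U} {e : Exp U} {l} :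
      e.eval = some (.loc l) → .locked l ∉ h →
      STStep (insert (.locked l) h) (.release e) (insert (.unlocked l) h) .tt none

/-- A thread of a thread pool: a command or the mark of a terminated thread. -/
inductive Thread (U : BaseSets.{u}) : Type u
  | run (c : Cmd U) : Thread U
  | term : Thread U

/-- Finite partial functions from thread IDs. -/
abbrev PoolOf (U : BaseSets.{u}) (X : Type v) : Type (max u v) := Finmap fun _ : U.TID => X

theorem PoolOf.exists_fresh {U : BaseSets.{u}} {X : Type v} (tp : PoolOf U X) :
    {t : U.TID | t ∉ tp}.Nonempty := by
  obtain ⟨t, ht⟩ := Infinite.exists_notMem_finset tp.keys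
  exact ⟨t, fun h => ht (Finmap.mem_keys.mpr h)⟩

/-- The least unused thread ID. -/
def PoolOf.freshTID {U : BaseSets.{u}} {X : Type v} (tp : PoolOf U X) : U.TID :=
  (wellFounded_lt (α := U.TID)).min {t | t ∉ tp} tp.exists_fresh

/-- Adding at most one new thread. -/
def PoolOf.add {U : BaseSets.{u}} {X : Type v} (tp : PoolOf U X) : Option X → PoolOf U X
  | none => tp
  | some x => tp.insert tp.freshTID x

abbrev ThreadPool (U : BaseSets.{u}) : Type u := PoolOf U (Thread U)

/-- `TPStep t h tp h' tp'`: plain reduction step of thread `t`. -/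
inductive TPStep {U : BaseSets.{u}} (t : U.TID) :
    PhysHeap U → ThreadPool U → PhysHeap U → ThreadPool U → Prop
  | lift {h c h' c' T} {tp : ThreadPool U} :
      tp.lookup t = some (.run c) → STStep h c h' c' T →
      TPStep t h tp h' (PoolOf.add (tp.insert t (.run c')) (T.map .run))
  | term (h) {e : Exp U} {w} {tp : ThreadPool U} :
      tp.lookup t = some (.run (.exp e)) → e.eval = some w →
      TPStep t h tp h (tp.insert t .term)

/-! ## Assertions -/

/-- Bags (multisets), possibly infinite. Union is pointwise addition. -/
abbrev Bag (X : Type u) : Type u := X → ℕ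

def Bag.single {X : Type u} (x : X) : Bag X :=
  letI := Classical.decEq X
  Pi.single x 1

abbrev Frac : Type := {q : ℚ≥0 // 0 < q ∧ q ≤ 1}

inductive PhaseLit : Type
  | forker : PhaseLit
  | forkee : PhaseLit

/-- Phase IDs; `ι₁ <+: ι₂` says that `ι₁` is a (non-strict) prefix of `ι₂`. -/
abbrev PhaseID : Type := List PhaseLit

abbrev Signal (U : BaseSets.{u}) : Type u := U.ID × U.Level
abbrev Mutex (U : BaseSets.{u}) : Type u := U.HLoc × U.Level
abbrev Ob (U : BaseSets.{u}) : Type u := (U.HLoc ⊕ U.ID) × U.Level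

/-- The obligation to set a signal. -/
abbrev Ob.ofSignal {U : BaseSets.{u}} (s : Signal U) : Ob U := (Sum.inr s.1, s.2)
/-- The obligation to release a mutex. -/
abbrev Ob.ofMutex {U : BaseSets.{u}} (m : Mutex U) : Ob U := (Sum.inl m.1, m.2)

/-- The level `L` is lower than the levels of all obligations in `O`. -/
def LevelBelow {U : BaseSets.{u}} (L : U.Level) (O : Bag (Ob U)) : Prop :=
  ∀ o : Ob U, 0 < O o → L < o.2

/-- Assertions. `bigOr` is the disjunction of a set of assertions, given as a family that is
indexed by a type in an arbitrary universe. -/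
inductive Assertion (U : BaseSets.{u}) : Type (max u (v + 1))
  | tru : Assertion U
  | fls : Assertion U
  | neg (A : Assertion U) : Assertion U
  | and (A B : Assertion U) : Assertion U
  | or (A B : Assertion U) : Assertion U
  | star (A B : Assertion U) : Assertion U
  | pointsTo (f : Frac) (l : U.HLoc) (w : Val U) : Assertion U
  | ghostPointsTo (f : Frac) (g : U.GLoc) (w : U.GVal) : Assertion U
  | bigOr (I : Type v) (A : I → Assertion U) : Assertion U
  | uninit (f : Frac) (l : U.HLoc) : Assertion U
  | mutex (f : Frac) (m : Mutex U) (P : Assertion U) : Assertion U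
  | locked (f : Frac) (m : Mutex U) (P : Assertion U) (fu : Frac) : Assertion U
  | signal (f : Frac) (s : Signal U) (b : Bool) : Assertion U
  | phase (i : PhaseID) : Assertion U
  | obs (O : Bag (Ob U)) : Assertion U
  | waitPerm (i : PhaseID) (id : U.ID) (d : U.Degree) : Assertion U
  | itPerm (i : PhaseID) (d : U.Degree) : Assertion U

/-! ## Logical heaps -/

inductive LogRes (U : BaseSets.{u}) : Type (max u (v + 1))
  | pointsTo (l : U.HLoc) (w : Val U) : LogRes U
  | ghostPointsTo (g : U.GLoc) (w : U.GVal) : LogRes U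
  | signal (s : Signal U) (b : Bool) : LogRes U
  | uninit (l : U.HLoc) : LogRes U
  | mutex (m : Mutex U) (P : Assertion.{u, v} U) : LogRes U
  | locked (m : Mutex U) (P : Assertion.{u, v} U) (f : Frac) : LogRes U
  | phase (i : PhaseID) : LogRes U
  | obs (O : Bag (Ob U)) : LogRes U
  | waitPerm (i : PhaseID) (id : U.ID) (d : U.Degree) : LogRes U
  | itPerm (i : PhaseID) (d : U.Degree) : LogRes U

instance (U : BaseSets.{u}) : DecidableEq (LogRes.{u, v} U) := Classical.decEq _

def LogRes.hlocs {U : BaseSets.{u}} : LogRes.{u, v} U → Set U.HLoc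
  | .pointsTo l _ => {l}
  | .uninit l => {l}
  | .mutex m _ => {m.1}
  | .locked m _ _ => {m.1}
  | _ => ∅

def LogRes.glocs {U : BaseSets.{u}} : LogRes.{u, v} U → Set U.GLoc
  | .ghostPointsTo g _ => {g}
  | _ => ∅

/-- Logical heaps, with pointwise addition and multiplication by nonnegative rationals;
`0` is the empty logical heap. -/
abbrev LogHeap (U : BaseSets.{u}) : Type (max u (v + 1)) := LogRes.{u, v} U → ℚ≥0

namespace LogHeap
variable {U : BaseSets.{u}}

/-- The logical heap that consists of exactly one full chunk `r`. -/
def single (r : LogRes.{u, v} U) : LogHeap.{u, v} U := Pi.single r 1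

/-- The logical heap `⟦r₁, …, rₙ⟧`, in set notation: value `1` on the listed resources, repeated
or not, and `0` elsewhere. -/
def ofSet (rs : List (LogRes.{u, v} U)) : LogHeap.{u, v} U := fun r => if r ∈ rs then 1 else 0

/-- The logical heap `⟦r₁⟧ + … + ⟦rₙ⟧`, which counts repeated resources with multiplicity. -/
def ofMultiset (rs : List (LogRes.{u, v} U)) : LogHeap.{u, v} U := (rs.map single).sum

/-- Allocated ghost locations. -/
def glocs (lh : LogHeap.{u, v} U) : Set U.GLoc := {g | ∃ r, 0 < lh r ∧ g ∈ r.glocs}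

/-- Exactly one obligations chunk and exactly one phase chunk. -/
def Complete (lh : LogHeap.{u, v} U) : Prop :=
  ∃ (O : Bag (Ob U)) (i : PhaseID), lh (.obs O) = 1 ∧ lh (.phase i) = 1 ∧
    (∀ O', O ≠ O' → ¬ 0 < lh (.obs O')) ∧ (∀ i', i ≠ i' → ¬ 0 < lh (.phase i'))

/-- The heap is complete and its only obligations chunk is that of the bag `O`. -/
def HasObs (lh : LogHeap.{u, v} U) (O : Bag (Ob U)) : Prop :=
  lh.Complete ∧ lh (.obs O) = 1

/-- The heap contains neither phase nor obligations chunks. -/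
def NoPhaseNoObs (lh : LogHeap.{u, v} U) : Prop :=
  (∀ i, lh (.phase i) = 0) ∧ (∀ O, lh (.obs O) = 0)

/-- Only full phase, obligations, wait and iteration permission chunks; heap locations and ghost
locations are unique. -/
def Consistent (lh : LogHeap.{u, v} U) : Prop :=
  (∀ i, ∃ n : ℕ, lh (.phase i) = n) ∧
  (∀ O, ∃ n : ℕ, lh (.obs O) = n) ∧
  (∀ i id d, ∃ n : ℕ, lh (.waitPerm i id d) = n) ∧
  (∀ i d, ∃ n : ℕ, lh (.itPerm i d) = n) ∧
  ¬ ∃ r₁ r₂ : LogRes.{u, v} U, r₁ ≠ r₂ ∧ 0 < lh r₁ ∧ 0 < lh r₂ ∧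
    ((r₁.hlocs ∩ r₂.hlocs).Nonempty ∨ (r₁.glocs ∩ r₂.glocs).Nonempty)

end LogHeap

/-- The model relation of assertions. -/
def Models {U : BaseSets.{u}} : LogHeap.{u, v} U → Assertion.{u, v} U → Prop
  | _, .tru => True
  | _, .fls => False
  | lh, .neg A => ¬ Models lh A
  | lh, .and A B => Models lh A ∧ Models lh B
  | lh, .or A B => Models lh A ∨ Models lh B
  | lh, .star A B => ∃ lh₁ lh₂, lh = lh₁ + lh₂ ∧ Models lh₁ A ∧ Models lh₂ B
  | lh, .pointsTo f l w => f.1 ≤ lh (.pointsTo l w)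
  | lh, .ghostPointsTo f g w => f.1 ≤ lh (.ghostPointsTo g w)
  | lh, .bigOr _ A => ∃ i, Models lh (A i)
  | lh, .uninit f l => f.1 ≤ lh (.uninit l)
  | lh, .mutex f m P => f.1 ≤ lh (.mutex m P)
  | lh, .locked f m P fu => f.1 ≤ lh (.locked m P fu)
  | lh, .signal f s b => f.1 ≤ lh (.signal s b)
  | lh, .phase i => 1 ≤ lh (.phase i)
  | lh, .obs O => 1 ≤ lh (.obs O)
  | lh, .waitPerm i id d => 1 ≤ lh (.waitPerm i id d)
  | lh, .itPerm i d => 1 ≤ lh (.itPerm i d)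

/-! ## Annotated heaps and annotated semantics -/

inductive AnnoRes (U : BaseSets.{u}) : Type (max u (v + 1))
  | pointsTo (l : U.HLoc) (w : Val U) : AnnoRes U
  | uninit (l : U.HLoc) : AnnoRes U
  /-- An unlocked mutex with its invariant and the logical heap that it protects. -/
  | unlocked (m : Mutex U) (P : Assertion.{u, v} U) (lh : LogHeap.{u, v} U) : AnnoRes U
  | locked (m : Mutex U) (P : Assertion.{u, v} U) (f : Frac) : AnnoRes U
  | signal (s : Signal U) (b : Bool) : AnnoRes U

instance (U : BaseSets.{u}) : DecidableEq (AnnoRes.{u, v} U) := Classical.decEq _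

abbrev AnnoHeap (U : BaseSets.{u}) : Type (max u (v + 1)) := Finset (AnnoRes.{u, v} U)

/-- Allocated heap locations of an annotated heap. -/
def AnnoHeap.locs {U : BaseSets.{u}} (ah : AnnoHeap.{u, v} U) : Set U.HLoc :=
  {l | (∃ w, .pointsTo l w ∈ ah) ∨ .uninit l ∈ ah ∨
    (∃ L P lh, .unlocked (l, L) P lh ∈ ah) ∨ (∃ L P f, .locked (l, L) P f ∈ ah)}

/-- Allocated signal IDs of an annotated heap. -/
def AnnoHeap.ids {U : BaseSets.{u}} (ah : AnnoHeap.{u, v} U) : Set U.ID :=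
  {id | ∃ L b, .signal (id, L) b ∈ ah}

open LogHeap (single)

/-- `ASTStep ah lh c ah' lh' c' T`: reduction of a single annotated thread with thread-local
logical heap `lh`; `T` is the at most one forked annotated thread. -/
inductive ASTStep {U : BaseSets.{u}} :
    AnnoHeap.{u, v} U → LogHeap.{u, v} U → Cmd U → AnnoHeap.{u, v} U → LogHeap.{u, v} U → Cmd U →
      Option (LogHeap.{u, v} U × Cmd U) → Prop
  | evalCtxt {ah lh c ah' lh' c' T} (E : EvalCtxt U) :
      ASTStep ah lh c ah' lh' c' T → ASTStep ah lh (E.fill c) ah' lh' (E.fill c') T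
  /-- The phase is split, and the obligations and the other resources are distributed over the
  forking and the forked thread. -/
  | fork (ah lh lhf i Om Of c) :
      ASTStep ah (lh + lhf + single (.phase i) + single (.obs (Om + Of))) (.fork c)
        ah (lh + single (.phase (i ++ [.forker])) + single (.obs Om)) .tt
        (some (lhf + single (.phase (i ++ [.forkee])) + single (.obs Of), c))
  /-- Unfolds to `if c then (consumeItPerm; while c do skip)`. -/
  | while (ah lh) {x : U.Var} {c : Cmd U} :
      x ∉ (Cmd.while c).fv →
      ASTStep ah lh (.while c) ah lh (.ifThen c (.letIn x .consumeItPerm (.while c))) none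
  | ifTrue (ah lh) {e : Exp U} (c) :
      e.eval = some (.bool true) → ASTStep ah lh (.ifThen (.exp e) c) ah lh c none
  | ifFalse (ah lh) {e : Exp U} (c) :
      e.eval = some (.bool false) → ASTStep ah lh (.ifThen (.exp e) c) ah lh .tt none
  | letIn (ah lh) (x : U.Var) {e : Exp U} {w} (c) :
      e.eval = some w → ASTStep ah lh (.letIn x (.exp e) c) ah lh (c.subst x w) none
  /-- The consumed permission is qualified by an ancestor of the phase of the thread. -/
  | consumeItPerm (ah lh) {i' i : PhaseID} (d : U.Degree) :
      i' <+: i →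
      ASTStep ah (lh + single (.phase i) + single (.itPerm i' d)) .consumeItPerm
        ah (lh + single (.phase i)) .tt none
  | alloc {ah : AnnoHeap U} (lh) {e : Exp U} {w l} :
      e.eval = some w → l ∉ ah.locs →
      ASTStep ah lh (.alloc e)
        (insert (.pointsTo l w) ah) (lh + single (.pointsTo l w)) (.ofVal (.loc l)) none
  | read {ah : AnnoHeap U} (lh) {e : Exp U} {l w} :
      e.eval = some (.loc l) → .pointsTo l w ∈ ah →
      ASTStep ah lh (.read e) ah lh (.ofVal w) none
  | assign {ah : AnnoHeap U} (lh) {e₁ e₂ : Exp U} {l w w'} :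
      e₁.eval = some (.loc l) → e₂.eval = some w' → .pointsTo l w ∉ ah →
      ASTStep (insert (.pointsTo l w) ah) (lh + single (.pointsTo l w)) (.assign e₁ e₂)
        (insert (.pointsTo l w') ah) (lh + single (.pointsTo l w')) .tt none
  | newMutex {ah : AnnoHeap U} (lh) {l} :
      l ∉ ah.locs →
      ASTStep ah lh .newMutex
        (insert (.uninit l) ah) (lh + single (.uninit l)) (.ofVal (.loc l)) none
  | acquire {ah : AnnoHeap U} (lh) {e : Exp U} {m : Mutex U} {P lhP} (f : Frac) {O} :
      e.eval = some (.loc m.1) → .unlocked m P lhP ∉ ah → LevelBelow m.2 O →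
      ASTStep (insert (.unlocked m P lhP) ah)
        (lh + f.1 • single (.mutex m P) + single (.obs O)) (.acquire e)
        (insert (.locked m P f) ah)
        (lh + lhP + single (.locked m P f) + single (.obs (O + Bag.single (.ofMutex m)))) .tt none
  /-- The part `lhP` of the thread's heap, which satisfies the lock invariant, goes to the lock;
  a thread cannot give up its phase and obligations chunks in this way. -/
  | release {ah : AnnoHeap U} (lh) {e : Exp U} {m : Mutex U} {P lhP} {f : Frac} (O) :
      e.eval = some (.loc m.1) → .locked m P f ∉ ah → Models lhP P → lhP.NoPhaseNoObs →
      ASTStep (insert (.locked m P f) ah)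
        (lh + lhP + single (.locked m P f) + single (.obs (O + Bag.single (.ofMutex m))))
        (.release e)
        (insert (.unlocked m P lhP) ah)
        (lh + f.1 • single (.mutex m P) + single (.obs O)) .tt none

/-- Annotated threads: a thread-local logical heap and a command or the termination mark. -/
abbrev AnnoThread (U : BaseSets.{u}) : Type (max u (v + 1)) := LogHeap.{u, v} U × Thread U

abbrev AnnoPool (U : BaseSets.{u}) : Type (max u (v + 1)) := PoolOf U (AnnoThread.{u, v} U)

/-- Sum of all thread-local logical heaps. -/
def AnnoPool.owned {U : BaseSets.{u}} (atp : AnnoPool.{u, v} U) : LogHeap.{u, v} U :=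
  ∑ t ∈ atp.keys, (atp.lookup t).elim 0 Prod.fst

/-- The logical heap that an annotated resource protects as an unlocked lock. -/
def AnnoRes.protectedHeap {U : BaseSets.{u}} : AnnoRes.{u, v} U → LogHeap.{u, v} U
  | .unlocked _ _ lhP => lhP
  | _ => 0

/-- Sum of all logical heaps protected by unlocked locks. -/
def AnnoHeap.protectedHeap {U : BaseSets.{u}} (ah : AnnoHeap.{u, v} U) : LogHeap.{u, v} U :=
  ∑ a ∈ ah, a.protectedHeap

/-- `GhostStep t σ ah atp ah' atp'`: ghost step of the (not yet terminated) thread `t`. The label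
is `σ = some s` if the step applies the wait rule to the signal `s`, and `none` otherwise. -/
inductive GhostStep {U : BaseSets.{u}} (t : U.TID) : Option (Signal U) →
    AnnoHeap.{u, v} U → AnnoPool.{u, v} U → AnnoHeap.{u, v} U → AnnoPool.{u, v} U → Prop
  | newSignal {ah : AnnoHeap U} {atp : AnnoPool U} {lh O c} {id : U.ID} (L : U.Level) :
      id ∉ ah.ids → atp.lookup t = some (lh + single (.obs O), .run c) →
      GhostStep t none ah atp (insert (.signal (id, L) false) ah)
        (atp.insert t (lh + single (.signal (id, L) false)
          + single (.obs (O + Bag.single (.ofSignal (id, L)))), .run c))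
  | setSignal {ah : AnnoHeap U} {atp : AnnoPool U} {lh O c} {s : Signal U} :
      .signal s false ∉ ah →
      atp.lookup t = some (lh + single (.signal s false)
        + single (.obs (O + Bag.single (.ofSignal s))), .run c) →
      GhostStep t none (insert (.signal s false) ah) atp (insert (.signal s true) ah)
        (atp.insert t (lh + single (.signal s true) + single (.obs O), .run c))
  | waitPerm (ah) {atp : AnnoPool U} {lh c i} {d d' : U.Degree} (id : U.ID) :
      d' < d → atp.lookup t = some (lh + single (.itPerm i d), .run c) →
      GhostStep t none ah atp ah (atp.insert t (lh + single (.waitPerm i id d'), .run c))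
  /-- Waiting for an unset signal of a level below that of all obligations of the thread yields an
  iteration permission that is qualified by the phase of the thread. -/
  | wait {ah : AnnoHeap U} {atp : AnnoPool U} {lh c} {i' i : PhaseID} {O d} {s : Signal U} :
      i' <+: i → LevelBelow s.2 O → .signal s false ∈ ah →
      atp.lookup t = some
        (lh + single (.phase i) + single (.obs O) + single (.waitPerm i' s.1 d), .run c) →
      GhostStep t (some s) ah atp ah
        (atp.insert t (lh + single (.phase i) + single (.obs O) + single (.waitPerm i' s.1 d)
          + single (.itPerm i d), .run c))
  | specItPerm (ah) {atp : AnnoPool U} {lh c d} {i i' : PhaseID} :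
      i <+: i' → atp.lookup t = some (lh + single (.itPerm i d), .run c) →
      GhostStep t none ah atp ah (atp.insert t (lh + single (.itPerm i' d), .run c))
  | specWaitPerm (ah) {atp : AnnoPool U} {lh c id d} {i i' : PhaseID} :
      i <+: i' → atp.lookup t = some (lh + single (.waitPerm i id d), .run c) →
      GhostStep t none ah atp ah (atp.insert t (lh + single (.waitPerm i' id d), .run c))
  | weakItPerm (ah) {atp : AnnoPool U} {lh c i} {d d' : U.Degree} (n : ℕ) :
      d' < d → atp.lookup t = some (lh + single (.itPerm i d), .run c) →
      GhostStep t none ah atp ah (atp.insert t (lh + n • single (.itPerm i d'), .run c))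
  | mutInit {ah : AnnoHeap U} {atp : AnnoPool U} {lh lhP P c l} (L : U.Level) :
      .uninit l ∉ ah → Models lhP P → lhP.NoPhaseNoObs →
      atp.lookup t = some (lh + lhP + single (.uninit l), .run c) →
      GhostStep t none (insert (.uninit l) ah) atp (insert (.unlocked (l, L) P lhP) ah)
        (atp.insert t (lh + single (.mutex (l, L) P), .run c))
  | newGhostCell {ah : AnnoHeap U} {atp : AnnoPool U} {lh c g} (w : U.GVal) :
      g ∉ (atp.owned + ah.protectedHeap).glocs → atp.lookup t = some (lh, .run c) →
      GhostStep t none ah atp ah (atp.insert t (lh + single (.ghostPointsTo g w), .run c))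
  | mutateGhostCell (ah) {atp : AnnoPool U} {lh c g w} (w' : U.GVal) :
      atp.lookup t = some (lh + single (.ghostPointsTo g w), .run c) →
      GhostStep t none ah atp ah (atp.insert t (lh + single (.ghostPointsTo g w'), .run c))

/-- `RealStep t ah atp ah' atp'`: non-ghost step of thread `t`. A thread can only terminate if it
holds no obligations. -/
inductive RealStep {U : BaseSets.{u}} (t : U.TID) :
    AnnoHeap.{u, v} U → AnnoPool.{u, v} U → AnnoHeap.{u, v} U → AnnoPool.{u, v} U → Prop
  | lift {ah lh c ah' lh' c' T} {atp : AnnoPool U} :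
      atp.lookup t = some (lh, .run c) → ASTStep ah lh c ah' lh' c' T →
      RealStep t ah atp ah'
        (PoolOf.add (atp.insert t (lh', .run c')) (T.map fun p => (p.1, .run p.2)))
  | term (ah) {lh : LogHeap U} {e : Exp U} {w} {atp : AnnoPool U} :
      atp.lookup t = some (lh, .run (.exp e)) → e.eval = some w → lh.HasObs 0 →
      RealStep t ah atp ah (atp.insert t (lh, .term))

/-- Reflexive transitive closure of the ghost steps of thread `t`. -/
def GhostSteps {U : BaseSets.{u}} (t : U.TID) (ah : AnnoHeap.{u, v} U) (atp : AnnoPool.{u, v} U)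
    (ah' : AnnoHeap.{u, v} U) (atp' : AnnoPool.{u, v} U) : Prop :=
  Relation.ReflTransGen
    (fun p q : AnnoHeap.{u, v} U × AnnoPool.{u, v} U => ∃ σ, GhostStep t σ p.1 p.2 q.1 q.2)
    (ah, atp) (ah', atp')

/-- Annotated thread pool step, ghost or real, labelled as in `GhostStep`. -/
def AnnoStep {U : BaseSets.{u}} (t : U.TID) (σ : Option (Signal U)) (ah : AnnoHeap.{u, v} U)
    (atp : AnnoPool.{u, v} U) (ah' : AnnoHeap.{u, v} U) (atp' : AnnoPool.{u, v} U) : Prop :=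
  GhostStep t σ ah atp ah' atp' ∨ (σ = none ∧ RealStep t ah atp ah' atp')

/-- Infinite annotated reduction sequences with signal annotation `σ`. -/
def IsAnnoRedSeq {U : BaseSets.{u}} (ah : ℕ → AnnoHeap.{u, v} U) (atp : ℕ → AnnoPool.{u, v} U)
    (σ : ℕ → Option (Signal U)) : Prop :=
  ∃ t : ℕ → U.TID, ∀ k, AnnoStep (t k) (σ k) (ah k) (atp k) (ah (k + 1)) (atp (k + 1))

/-- Every thread that has not terminated is eventually scheduled for a real step. -/
def IsFair {U : BaseSets.{u}} (ah : ℕ → AnnoHeap.{u, v} U) (atp : ℕ → AnnoPool.{u, v} U) : Prop :=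
  ∀ (k : ℕ) (t : U.TID) (lh : LogHeap.{u, v} U) (c : Cmd U),
    (atp k).lookup t = some (lh, .run c) →
    ∃ n, k ≤ n ∧ RealStep t (ah n) (atp n) (ah (n + 1)) (atp (n + 1))

/-! ## Compatibility and consistency -/

/-- Compatibility of annotated and logical heaps. -/
inductive AnnoLogCompat {U : BaseSets.{u}} : AnnoHeap.{u, v} U → LogHeap.{u, v} U → Prop
  | empty : AnnoLogCompat ∅ 0
  | pointsTo {ah lh l} (w) : AnnoLogCompat ah lh → l ∉ ah.locs →
      AnnoLogCompat (insert (.pointsTo l w) ah) (lh + single (.pointsTo l w))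
  | uninit {ah lh l} : AnnoLogCompat ah lh → l ∉ ah.locs →
      AnnoLogCompat (insert (.uninit l) ah) (lh + single (.uninit l))
  | unlocked {ah lh} {m : Mutex U} (P lhP) : AnnoLogCompat ah lh → m.1 ∉ ah.locs →
      AnnoLogCompat (insert (.unlocked m P lhP) ah) (lh + single (.mutex m P) + lhP)
  | locked {ah lh} {m : Mutex U} (P) (f : Frac) : AnnoLogCompat ah lh → m.1 ∉ ah.locs →
      AnnoLogCompat (insert (.locked m P f) ah)
        (lh + single (.locked m P f) + (1 - f.1) • single (.mutex m P))
  | signal {ah lh} {s : Signal U} (b) : AnnoLogCompat ah lh → s.1 ∉ ah.ids →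
      AnnoLogCompat (insert (.signal s b) ah) (lh + single (.signal s b))
  | phase {ah lh} (i) : AnnoLogCompat ah lh → AnnoLogCompat ah (lh + single (.phase i))
  | obs {ah lh} (O) : AnnoLogCompat ah lh → AnnoLogCompat ah (lh + single (.obs O))
  | waitPerm {ah lh} (i id d) : AnnoLogCompat ah lh →
      AnnoLogCompat ah (lh + single (.waitPerm i id d))
  | itPerm {ah lh} (i d) : AnnoLogCompat ah lh → AnnoLogCompat ah (lh + single (.itPerm i d))
  | ghostPointsTo {ah lh} (g w) : AnnoLogCompat ah lh →
      AnnoLogCompat ah (lh + single (.ghostPointsTo g w))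

/-- Compatibility of annotated and physical heaps. -/
inductive AnnoPhysCompat {U : BaseSets.{u}} : AnnoHeap.{u, v} U → PhysHeap U → Prop
  | empty : AnnoPhysCompat ∅ ∅
  | pointsTo {ah ph} (l w) : AnnoPhysCompat ah ph →
      AnnoPhysCompat (insert (.pointsTo l w) ah) (insert (.pointsTo l w) ph)
  | uninit {ah ph} (l) : AnnoPhysCompat ah ph →
      AnnoPhysCompat (insert (.uninit l) ah) (insert (.unlocked l) ph)
  | unlocked {ah ph} (m : Mutex U) (P lhP) : AnnoPhysCompat ah ph →
      AnnoPhysCompat (insert (.unlocked m P lhP) ah) (insert (.unlocked m.1) ph)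
  | locked {ah ph} (m : Mutex U) (P f) : AnnoPhysCompat ah ph →
      AnnoPhysCompat (insert (.locked m P f) ah) (insert (.locked m.1) ph)
  | signal {ah ph} (s b) : AnnoPhysCompat ah ph → AnnoPhysCompat (insert (.signal s b) ah) ph

/-- Consistency of annotated machine configurations. -/
def ConfConsistent {U : BaseSets.{u}} (ah : AnnoHeap.{u, v} U) (atp : AnnoPool.{u, v} U) : Prop :=
  (∀ t lh T, atp.lookup t = some (lh, T) → lh.Consistent) ∧
  (∀ m P lhP, .unlocked m P lhP ∈ ah → lhP.Consistent) ∧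
  AnnoLogCompat ah (atp.owned + ah.protectedHeap)

/-! ## Safety and the model relation for Hoare triples -/

open Classical in
/-- Removal of all occurrences of `consumeItPerm`: `consumeItPerm; c` becomes `c`, and an
occurrence that is not the first part of a sequence becomes the unit value. -/
def Cmd.erase {U : BaseSets.{u}} : Cmd U → Cmd U
  | .while c => .while c.erase
  | .fork c => .fork c.erase
  | .letIn x c₁ c₂ =>
    if c₁ = .consumeItPerm ∧ x ∉ c₂.fv then c₂.erase else .letIn x c₁.erase c₂.erase
  | .ifThen c₁ c₂ => .ifThen c₁.erase c₂.erase
  | .consumeItPerm => .tt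
  | .alloc e => .alloc e
  | .read e => .read e
  | .assign e₁ e₂ => .assign e₁ e₂
  | .newMutex => .newMutex
  | .acquire e => .acquire e
  | .release e => .release e
  | .exp e => .exp e

def Thread.erase {U : BaseSets.{u}} : Thread U → Thread U
  | .run c => .run c.erase
  | .term => .term

/-- The annotated thread pool `atp` is an annotation of the plain thread pool `tp`. -/
def PoolAnnot {U : BaseSets.{u}} (atp : AnnoPool.{u, v} U) (tp : ThreadPool U) : Prop :=
  ∀ t, tp.lookup t = (atp.lookup t).map fun a => a.2.erase

/-- The right-hand side of the equation that defines safety. -/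
def SafeBody {U : BaseSets.{u}} (S : LogHeap.{u, v} U → Cmd U → Prop)
    (lh : LogHeap.{u, v} U) (c : Cmd U) : Prop :=
  lh.Complete →
  ∀ (tp tp' : ThreadPool U) (t : U.TID), t ∈ tp → ∀ (ph ph' : PhysHeap U)
    (atp : AnnoPool.{u, v} U) (ah : AnnoHeap.{u, v} U),
    ConfConsistent ah atp ∧ AnnoPhysCompat ah ph ∧
    tp.lookup t = some (.run c) ∧ atp.lookup t = some (lh, .run c) ∧
    PoolAnnot atp tp ∧ TPStep t ph tp ph' tp' →
    ∃ (atpG atp' : AnnoPool.{u, v} U) (ahG ah' : AnnoHeap.{u, v} U),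
      GhostSteps t ah atp ahG atpG ∧ RealStep t ahG atpG ah' atp' ∧
      PoolAnnot atp' tp' ∧ AnnoPhysCompat ah' ph' ∧
      ∀ (lhf : LogHeap.{u, v} U) (cf : Cmd U),
        (∃ t', atp'.lookup t' = some (lhf, .run cf)) →
        (¬ ∃ t', atp.lookup t' = some (lhf, .run cf)) → S lhf cf

/-- Safety: the greatest solution of `S = SafeBody S`, as the union of all post-fixed points of
the monotone operator `SafeBody`. -/
def Safe {U : BaseSets.{u}} (lh : LogHeap.{u, v} U) (c : Cmd U) : Prop :=
  ∃ S : LogHeap.{u, v} U → Cmd U → Prop, (∀ lh c, S lh c → SafeBody S lh c) ∧ S lh c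

/-- The model relation `⊨ {A} c {r. B r}` for Hoare triples. -/
def HoareModels {U : BaseSets.{u}} (A : Assertion.{u, v} U) (c : Cmd U)
    (B : Val U → Assertion.{u, v} U) : Prop :=
  ∀ (lhF : LogHeap.{u, v} U) (E : EvalCtxt U),
    (∀ (w : Val U) (lhB : LogHeap.{u, v} U), Models lhB (B w) → Safe (lhB + lhF) (E.fill (.ofVal w))) →
    ∀ lhA : LogHeap.{u, v} U, Models lhA A → Safe (lhA + lhF) (E.fill c)

/-- `phase(i) ∗ obs(∅) ∗ itPerm(i, d₁) ∗ … ∗ itPerm(i, dₙ)`. -/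
def initialAssertion {U : BaseSets.{u}} (i : PhaseID) {n : ℕ} (d : Fin n → U.Degree) :
    Assertion.{u, v} U :=
  (List.ofFn fun k => Assertion.itPerm i (d k)).foldl .star (.star (.phase i) (.obs 0))

/-- `phase(i), obs(∅), itPerm(i, d₁), …, itPerm(i, dₙ)`. -/
def initialResources {U : BaseSets.{u}} (i : PhaseID) {n : ℕ} (d : Fin n → U.Degree) :
    List (LogRes.{u, v} U) :=
  .phase i :: .obs 0 :: List.ofFn fun k => .itPerm i (d k)

end GhostSignals

end

open GhostSignals

namespace GhostSignals

open _root_.GhostSignals.LogHeap (single)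

/-! Suppose that there is such a sequence. Two finiteness arguments contradict each other.

Permissions. A phase set `Φ` closed under prefixes is fixed, together with a time after which each
signal is waited for only finitely often by threads with phase in `Φ`. An iteration permission of
degree `d` is credited with one copy of `d`, a wait permission of degree `d` for `id` with as many
copies of `d` as waits for `id` in `Φ` are still to come. In the Dershowitz-Manna order the credit
of the permissions in `Φ` never increases: weakening replaces a degree by finitely many smaller
ones, and a wait produces one copy of `d` but uses up one of the remaining waits. Each consumption
in `Φ` strictly decreases it, so there are finitely many consumptions in `Φ`
(`eventually_not_consumes`). A real step that consumes nothing decreases the weight of the acting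
thread, counted together with any thread it forks (`ASTStep.consumes_or_weight_lt`).

Signals. With `Φ` the set of all phases, finitely many waits for each signal would bound the number
of real steps, against fairness; so some signal is waited for infinitely often
(`exists_infinite_waits`). Let `s` be one of minimal level. It is never set, so at every time some
running thread is obliged to set it. This obligation moves only through forks, hence the phases of
its successive holders form a chain of prefixes. Let `Φ` consist of the prefixes of this chain.
Phases of distinct threads are incomparable (`Inv`), so a thread in `Φ` that waits is the current
holder of `s`, and the signal it waits for lies strictly below `s`. By minimality there are finitely
many waits for each such signal, so the holders eventually stop consuming. From then on each real
step of the holder decreases its weight, against fairness (`not_infinite_waits`). -/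

/-! ## Permissions, phases and obligations of a logical heap -/

/-- Iteration and wait permissions. -/
inductive Perm (U : BaseSets.{u}) : Type u
  | it (i : PhaseID) (d : U.Degree) : Perm U
  | wait (i : PhaseID) (id : U.ID) (d : U.Degree) : Perm U

noncomputable instance (U : BaseSets.{u}) : DecidableEq (Perm U) := Classical.decEq _

noncomputable instance : DecidableEq PhaseLit := Classical.decEq _

noncomputable instance (U : BaseSets.{u}) : DecidableEq (Bag (Ob U)) := Classical.decEq _

section
variable {U : BaseSets.{u}}

def Perm.phase : Perm U → PhaseID
  | .it i _ => i
  | .wait i _ _ => i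

def Perm.degree : Perm U → U.Degree
  | .it _ d => d
  | .wait _ _ d => d

/-- The permission qualified by another phase. -/
def Perm.withPhase (i : PhaseID) : Perm U → Perm U
  | .it _ d => .it i d
  | .wait _ id d => .wait i id d

def Perm.toRes : Perm U → LogRes.{u, v} U
  | .it i d => .itPerm i d
  | .wait i id d => .waitPerm i id d

/-- Multiplicities in a multiset, as a function to the nonnegative rationals. -/
noncomputable def mult (X : Multiset (Perm U)) : Perm U → ℚ≥0 := fun p => X.count p

theorem mult_singleton (p : Perm U) : mult {p} = Pi.single p 1 := by
  ext q
  simp [mult, Multiset.count_singleton, Pi.single_apply, eq_comm]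

theorem mult_add (X Y : Multiset (Perm U)) : mult (X + Y) = mult X + mult Y := by
  ext q
  simp [mult]

theorem mult_cons (p : Perm U) (X : Multiset (Perm U)) : mult (p ::ₘ X) = mult X + mult {p} := by
  rw [← Multiset.singleton_add, mult_add, add_comm]

theorem mult_replicate (n : ℕ) (p : Perm U) :
    mult (Multiset.replicate n p) = n • Pi.single p (1 : ℚ≥0) := by
  ext q
  simp [mult, Multiset.count_replicate, Pi.single_apply, eq_comm]

namespace LogHeap

/-- The permission chunks of a logical heap. -/
def perms : LogHeap.{u, v} U →+ (Perm U → ℚ≥0) where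
  toFun lh p := lh p.toRes
  map_zero' := rfl
  map_add' _ _ := rfl

/-- The phase chunks of a logical heap. -/
def phases : LogHeap.{u, v} U →+ (PhaseID → ℚ≥0) where
  toFun lh i := lh (.phase i)
  map_zero' := rfl
  map_add' _ _ := rfl

/-- The obligations chunks of a logical heap. -/
def bags : LogHeap.{u, v} U →+ (Bag (Ob U) → ℚ≥0) where
  toFun lh O := lh (.obs O)
  map_zero' := rfl
  map_add' _ _ := rfl

variable (lh : LogHeap.{u, v} U) (q : ℚ≥0)

@[simp] theorem perms_smul : perms (q • lh) = q • perms lh := rfl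
@[simp] theorem phases_smul : phases (q • lh) = q • phases lh := rfl
@[simp] theorem bags_smul : bags (q • lh) = q • bags lh := rfl

theorem perms_mono {lh lh' : LogHeap.{u, v} U} (h : lh ≤ lh') : perms lh ≤ perms lh' :=
  fun p => h p.toRes

/-- Permissions of a single chunk. -/
noncomputable def _root_.GhostSignals.LogRes.perms : LogRes.{u, v} U → Perm U → ℚ≥0
  | .itPerm i d => Pi.single (.it i d) 1
  | .waitPerm i id d => Pi.single (.wait i id d) 1
  | _ => 0

/-- Phases of a single chunk. -/
noncomputable def _root_.GhostSignals.LogRes.phases : LogRes.{u, v} U → PhaseID → ℚ≥0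
  | .phase i => Pi.single i 1
  | _ => 0

/-- Obligations of a single chunk. -/
noncomputable def _root_.GhostSignals.LogRes.bags : LogRes.{u, v} U → Bag (Ob U) → ℚ≥0
  | .obs O => Pi.single O 1
  | _ => 0

attribute [simp] LogRes.perms LogRes.phases LogRes.bags

@[simp] theorem perms_single (r : LogRes.{u, v} U) : perms (single r) = r.perms := by
  funext q
  cases r <;> cases q <;> simp [perms, single, Pi.single_apply, Perm.toRes] <;>
    exact if_congr (by simp) rfl rfl

@[simp] theorem phases_single (r : LogRes.{u, v} U) : phases (single r) = r.phases := by
  ext q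
  cases r <;> simp [phases, single, Pi.single_apply]

@[simp] theorem bags_single (r : LogRes.{u, v} U) : bags (single r) = r.bags := by
  ext q
  cases r <;> simp [bags, single, Pi.single_apply]

/-- The only phase chunk is a full chunk of `i`, the only obligations chunk a full one of `O`. -/
def Owns (lh : LogHeap.{u, v} U) (i : PhaseID) (O : Bag (Ob U)) : Prop :=
  phases lh = Pi.single i 1 ∧ bags lh = Pi.single O 1

theorem NoPhaseNoObs.phases_eq {lh : LogHeap.{u, v} U} (h : lh.NoPhaseNoObs) : phases lh = 0 :=
  funext h.1

theorem NoPhaseNoObs.bags_eq {lh : LogHeap.{u, v} U} (h : lh.NoPhaseNoObs) : bags lh = 0 :=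
  funext h.2

end LogHeap

open _root_.GhostSignals.LogHeap (perms phases bags)

/-- At `j` the left side is at least 1, which the right side allows only at `i`. Rules name a phase
or obligations chunk of the acting heap; this identifies it with the one the thread owns and shows
that the rest of the heap has none. -/
theorem eq_and_eq_zero_of_add_single {X : Type*} [DecidableEq X] {a : X → ℚ≥0} {i j : X}
    (h : a + Pi.single j 1 = Pi.single i 1) : j = i ∧ a = 0 := by
  have hj : j = i := by
    by_contra hne
    have := congrFun h j
    simp [hne] at this
  subst hj
  exact ⟨rfl, by simpa using h⟩

theorem single_one_injective {X : Type*} [DecidableEq X] {i j : X}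
    (h : (Pi.single i 1 : X → ℚ≥0) = Pi.single j 1) : i = j := by
  by_contra hne
  have := congrFun h i
  simp [hne] at this

theorem LogHeap.Owns.unique {lh : LogHeap.{u, v} U} {i i' O O'} (h : lh.Owns i O)
    (h' : lh.Owns i' O') : i = i' ∧ O = O' :=
  ⟨single_one_injective (h.1.symm.trans h'.1), single_one_injective (h.2.symm.trans h'.2)⟩

/-! ## Heaps protected by locks -/

/-- Only an inequality, because an annotated heap is a set: inserting a lock that is already present
loses the inserted copy. All permission bounds below are therefore upper bounds. -/
theorem protectedHeap_insert_le (ah : AnnoHeap.{u, v} U) (a : AnnoRes U) :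
    AnnoHeap.protectedHeap (insert a ah) ≤ a.protectedHeap + ah.protectedHeap := by
  unfold AnnoHeap.protectedHeap
  by_cases h : a ∈ ah
  · rw [Finset.insert_eq_of_mem h]
    exact le_add_of_nonneg_left (fun _ => zero_le)
  · rw [Finset.sum_insert h]

theorem protectedHeap_insert {ah : AnnoHeap.{u, v} U} {a : AnnoRes U} (h : a ∉ ah) :
    AnnoHeap.protectedHeap (insert a ah) = a.protectedHeap + ah.protectedHeap :=
  Finset.sum_insert h

section
variable (ah : AnnoHeap.{u, v} U)

@[simp] theorem protectedHeap_insert_pointsTo (l w) :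
    AnnoHeap.protectedHeap (insert (.pointsTo l w) ah) = ah.protectedHeap :=
  Finset.sum_insert_zero rfl

@[simp] theorem protectedHeap_insert_uninit (l) :
    AnnoHeap.protectedHeap (insert (.uninit l) ah) = ah.protectedHeap :=
  Finset.sum_insert_zero rfl

@[simp] theorem protectedHeap_insert_locked (m P f) :
    AnnoHeap.protectedHeap (insert (.locked m P f) ah) = ah.protectedHeap :=
  Finset.sum_insert_zero rfl

@[simp] theorem protectedHeap_insert_signal (s b) :
    AnnoHeap.protectedHeap (insert (.signal s b) ah) = ah.protectedHeap :=
  Finset.sum_insert_zero rfl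

end

/-! ## A measure of commands that decreases unless a permission is consumed -/

-- The body behind `consumeItPerm` is not counted, since it can run only after a permission has been
-- paid. This makes the unfolded loop weigh `c.weight + 2`, one less than the loop. The 2 for `fork`
-- pays for the new thread, whose weight as a thread is one more than that of its command.
open Classical in
noncomputable def Cmd.weight : Cmd U → ℕ
  | .while c => c.weight + 3
  | .fork c => c.weight + 2
  | .letIn _ c₁ c₂ => if c₁ = .consumeItPerm then 1 else 1 + c₁.weight + c₂.weight
  | .ifThen c₁ c₂ => 1 + c₁.weight + c₂.weight
  | .alloc _ => 1
  | .read _ => 1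
  | .assign _ _ => 1
  | .newMutex => 1
  | .acquire _ => 1
  | .release _ => 1
  | .exp _ => 0
  | .consumeItPerm => 0

/-- The extra 1 makes termination of a value a decreasing step. -/
noncomputable def Thread.weight : Thread U → ℕ
  | .run c => c.weight + 1
  | .term => 0

theorem Cmd.subst_eq_consumeItPerm (x : U.Var) (w : Val U) (c : Cmd U) :
    c.subst x w = .consumeItPerm ↔ c = .consumeItPerm := by
  cases c <;> simp [Cmd.subst]

theorem Cmd.weight_subst (x : U.Var) (w : Val U) (c : Cmd U) : (c.subst x w).weight = c.weight := by
  induction c with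
  | letIn y c₁ c₂ h₁ h₂ =>
    have h := Cmd.subst_eq_consumeItPerm x w c₁
    simp only [Cmd.subst, Cmd.weight, h₁]
    split_ifs <;> simp_all
  | newMutex | consumeItPerm => rfl
  | _ => simp_all [Cmd.subst, Cmd.weight]

/-- Here `n` stands for the weight of a forked thread. The hypothesis excludes `c = consumeItPerm`,
of weight 0, so a `let` around `c` counts its body in full; if `c'` is `consumeItPerm`, the new side
only gets smaller. -/
theorem EvalCtxt.weight_fill_lt (E : EvalCtxt U) {c c' : Cmd U} {n : ℕ}
    (h : c'.weight + n < c.weight) : (E.fill c').weight + n < (E.fill c).weight := by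
  cases E with
  | ifThen c₂ => simp only [EvalCtxt.fill, Cmd.weight]; omega
  | letIn x c₂ =>
    have hc : c ≠ .consumeItPerm := by rintro rfl; simp [Cmd.weight] at h
    simp only [EvalCtxt.fill, Cmd.weight, if_neg hc]
    split_ifs <;> omega

/-- A permission that is qualified by an ancestor of `i` is consumed. -/
def Consumes (i : PhaseID) (tot tot' : Perm U → ℚ≥0) : Prop :=
  ∃ i' d, i' <+: i ∧ tot' + Pi.single (.it i' d) 1 ≤ tot

/-- The permissions that are affected by a step of one thread. -/
noncomputable def localPerms (ah : AnnoHeap.{u, v} U) (lh : LogHeap.{u, v} U) : Perm U → ℚ≥0 :=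
  perms ah.protectedHeap + perms lh

/-- Real steps only move permissions between thread, lock and forked thread, or destroy them. The
only rule that does not decrease the weight is `consumeItPerm`, possibly below evaluation contexts;
the phase it mentions is the one owned by the thread. -/
theorem ASTStep.consumes_or_weight_lt {ah ah' : AnnoHeap.{u, v} U} {lh lh' c c' T}
    (h : ASTStep ah lh c ah' lh' c' T) :
    localPerms ah' lh' + perms ((T.map Prod.fst).getD 0) ≤ localPerms ah lh ∧
    ((∀ i O, lh.Owns i O →
      Consumes i (localPerms ah lh) (localPerms ah' lh' + perms ((T.map Prod.fst).getD 0))) ∨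
    c'.weight + T.elim 0 (fun p => p.2.weight + 1) < c.weight) := by
  induction h with
  | evalCtxt E _ ih => exact ⟨ih.1, ih.2.imp id E.weight_fill_lt⟩
  | fork ah lh lhf i Om Of c =>
    refine ⟨le_of_eq ?_, .inr (by simp [Cmd.weight])⟩
    simp [localPerms]
    abel
  | ifTrue => exact ⟨by simp, .inr (by simp [Cmd.weight])⟩
  | ifFalse => exact ⟨by simp, .inr (by simp [Cmd.weight])⟩
  | letIn => exact ⟨by simp, .inr (by simp [Cmd.weight, Cmd.weight_subst])⟩
  | @consumeItPerm ah lh i' i d hi =>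
    refine ⟨by simp [localPerms, ← add_assoc], .inl fun j O hO => ⟨i', d, ?_, ?_⟩⟩
    · have h1 := hO.1
      simp only [map_add, LogHeap.phases_single, LogRes.phases, add_zero] at h1
      exact (eq_and_eq_zero_of_add_single h1).1 ▸ hi
    · simp [localPerms, ← add_assoc]
  | alloc => exact ⟨by simp [localPerms],
      .inr (by simp [Cmd.weight])⟩
  | read => exact ⟨by simp, .inr (by simp [Cmd.weight])⟩
  | assign => exact ⟨by simp [localPerms],
      .inr (by simp [Cmd.weight])⟩
  | newMutex => exact ⟨by simp [localPerms],
      .inr (by simp [Cmd.weight])⟩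
  | @acquire ah lh e m P lhP f O _ hn =>
    refine ⟨le_of_eq ?_, .inr (by simp [Cmd.weight])⟩
    rw [localPerms, localPerms, protectedHeap_insert hn, protectedHeap_insert_locked]
    simp [AnnoRes.protectedHeap]
    abel
  | @release ah lh e m P lhP f O _ hn =>
    refine ⟨?_, .inr (by simp [Cmd.weight])⟩
    have := LogHeap.perms_mono (protectedHeap_insert_le ah (.unlocked m P lhP))
    rw [localPerms, localPerms, protectedHeap_insert_locked]
    simp only [AnnoRes.protectedHeap, map_add] at this
    simp only [map_add, LogHeap.perms_smul, LogHeap.perms_single, LogRes.perms, smul_zero,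
      Option.map_none, Option.getD_none, map_zero, add_zero]
    calc _ ≤ perms lhP + perms ah.protectedHeap + perms lh := by gcongr
      _ = _ := by abel
  | _ => exact ⟨by simp, .inr (by simp [Cmd.weight]; omega)⟩

/-! ## The effect of one step on the resources of a thread -/

/-- How the permissions in circulation change in a step of a thread with phase `i` and obligations
`O`; the label is the signal that is waited for. -/
inductive PermChange (i : PhaseID) (O : Bag (Ob U)) :
    Option (Signal U) → (Perm U → ℚ≥0) → (Perm U → ℚ≥0) → Prop
  | le {tot tot'} : tot' ≤ tot → PermChange i O none tot tot'
  | weaken {tot tot'} (j : PhaseID) (d : U.Degree) (X : Multiset (Perm U)) :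
      (∀ x ∈ X, x.phase = j ∧ x.degree < d) →
      tot' + mult {.it j d} ≤ tot + mult X → PermChange i O none tot tot'
  | spec {tot tot'} (p : Perm U) (j : PhaseID) :
      p.phase <+: j → tot' + mult {p} ≤ tot + mult {p.withPhase j} → PermChange i O none tot tot'
  | wait {tot tot'} (s : Signal U) (i' : PhaseID) (d : U.Degree) :
      i' <+: i → LevelBelow s.2 O → 1 ≤ tot (.wait i' s.1 d) →
      tot' ≤ tot + mult {.it i d} → PermChange i O (some s) tot tot'

/-- Frame property: `F` will be the permissions of the other threads. -/
theorem PermChange.add_left {i : PhaseID} {O : Bag (Ob U)} {σ tot tot'}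
    (h : PermChange i O σ tot tot') (F : Perm U → ℚ≥0) :
    PermChange i O σ (F + tot) (F + tot') := by
  cases h with
  | le h => exact .le (by gcongr)
  | weaken j d X hX h => exact .weaken j d X hX (by rw [add_assoc, add_assoc]; gcongr)
  | spec p j hj h => exact .spec p j hj (by rw [add_assoc, add_assoc]; gcongr)
  | wait s i' d hi hO h1 h =>
    exact .wait s i' d hi hO (h1.trans (le_add_of_nonneg_left zero_le))
      (by rw [add_assoc]; gcongr)

theorem Consumes.add_left {i : PhaseID} {tot tot' : Perm U → ℚ≥0} (h : Consumes i tot tot')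
    (F : Perm U → ℚ≥0) : Consumes i (F + tot) (F + tot') := by
  obtain ⟨i', d, hi, h⟩ := h
  exact ⟨i', d, hi, by rw [add_assoc]; gcongr⟩

/-- Locks protect neither phase nor obligations chunks. -/
def AnnoHeap.LocksPure (ah : AnnoHeap.{u, v} U) : Prop :=
  ∀ m P lhP, .unlocked m P lhP ∈ ah → lhP.NoPhaseNoObs

/-- The effect of a step with label `σ` of a thread with heap `lh`; `N` is the heap of the forked
thread. -/
structure StepSpec (σ : Option (Signal U)) (ah : AnnoHeap.{u, v} U) (lh : LogHeap.{u, v} U)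
    (ah' : AnnoHeap.{u, v} U) (lh' : LogHeap.{u, v} U) (N : Option (LogHeap.{u, v} U)) : Prop where
  locks : ah.LocksPure → ah'.LocksPure
  owns : ah.LocksPure → ∀ i O, lh.Owns i O → ∃ O',
    (N = none ∧ lh'.Owns i O' ∧
      ∀ s, .signal s false ∈ ah' → 0 < O (.ofSignal s) → 0 < O' (.ofSignal s)) ∨
    ∃ n Of, N = some n ∧ lh'.Owns (i ++ [.forker]) O' ∧ n.Owns (i ++ [.forkee]) Of ∧ O = O' + Of
  signals : (∀ s b, .signal s b ∈ ah' → ∃ b', .signal s b' ∈ ah ∧ (b = false → b' = false)) ∨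
    ∃ s₀ : Signal U, s₀.1 ∉ ah.ids ∧ (∀ i O, lh'.Owns i O → 0 < O (.ofSignal s₀)) ∧
      ∀ s b, .signal s b ∈ ah' → s = s₀ ∨ .signal s b ∈ ah
  signals_mono : ∀ s b, .signal s b ∈ ah → ∃ b', .signal s b' ∈ ah'
  wait : ∀ s, σ = some s → .signal s false ∈ ah
  perms : ∀ i O, lh.Owns i O →
    PermChange i O σ (localPerms ah lh) (localPerms ah' lh' + LogHeap.perms (N.getD 0))

theorem LogHeap.Owns.of_add_obs {lh : LogHeap.{u, v} U} {i B O}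
    (h : (lh + single (.obs B)).Owns i O) : B = O ∧ phases lh = Pi.single i 1 ∧ bags lh = 0 := by
  obtain ⟨h₁, h₂⟩ := h
  simp only [map_add, LogHeap.phases_single, LogHeap.bags_single, LogRes.phases, LogRes.bags,
    add_zero] at h₁ h₂
  obtain ⟨h₃, h₄⟩ := eq_and_eq_zero_of_add_single h₂
  exact ⟨h₃, h₁, h₄⟩

theorem Bag.single_apply_of_ne {X : Type u} {x y : X} (h : y ≠ x) : Bag.single x y = 0 := by
  simp [Bag.single, h]

theorem Bag.single_self {X : Type u} (x : X) : Bag.single x x = 1 := by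
  simp [Bag.single]

@[simp] theorem Bag.single_ofMutex_ofSignal (m : Mutex U) (s : Signal U) :
    Bag.single (Ob.ofMutex m) (Ob.ofSignal s) = 0 :=
  Bag.single_apply_of_ne (by simp [Ob.ofMutex, Ob.ofSignal])

/-- A step that creates or sets no signal and forks no thread. -/
theorem StepSpec.of_signals_eq {ah ah' : AnnoHeap.{u, v} U} {lh lh' : LogHeap.{u, v} U}
    (hl : ah.LocksPure → ah'.LocksPure)
    (ho : ah.LocksPure → ∀ i O, lh.Owns i O → ∃ O', lh'.Owns i O' ∧
      ∀ s : Signal U, O (.ofSignal s) = O' (.ofSignal s))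
    (hs : ∀ s b, .signal s b ∈ ah' ↔ .signal s b ∈ ah)
    (hp : ∀ i O, lh.Owns i O → PermChange i O none (localPerms ah lh) (localPerms ah' lh')) :
    StepSpec none ah lh ah' lh' none where
  locks := hl
  owns h i O hO := by
    obtain ⟨O', h', h''⟩ := ho h i O hO
    exact ⟨O', .inl ⟨rfl, h', fun s _ hs => h'' s ▸ hs⟩⟩
  signals := .inl fun s b h => ⟨b, (hs s b).1 h, id⟩
  signals_mono s b h := ⟨b, (hs s b).2 h⟩
  wait s h := by cases h
  perms i O h := by simpa using hp i O h

theorem StepSpec.of_heap_eq {ah ah' : AnnoHeap.{u, v} U} {lh lh' : LogHeap.{u, v} U}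
    (hl : ah.LocksPure → ah'.LocksPure)
    (hs : ∀ s b, .signal s b ∈ ah' ↔ .signal s b ∈ ah)
    (h₁ : phases lh' = phases lh) (h₂ : bags lh' = bags lh)
    (hp : localPerms ah' lh' ≤ localPerms ah lh) :
    StepSpec none ah lh ah' lh' none :=
  .of_signals_eq hl (fun _ _ O h => ⟨O, ⟨h₁ ▸ h.1, h₂ ▸ h.2⟩, fun _ => rfl⟩) hs
    fun _ _ _ => .le hp

/-- Real steps touch no signal chunk, and apart from forks they change the obligations only by
mutexes, which are never signal obligations. -/
theorem ASTStep.stepSpec {ah ah' : AnnoHeap.{u, v} U} {lh lh' c c' T}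
    (h : ASTStep ah lh c ah' lh' c' T) : StepSpec none ah lh ah' lh' (T.map Prod.fst) := by
  have hle := h.consumes_or_weight_lt.1
  induction h with
  | evalCtxt E _ ih => exact ih hle
  | fork ah lh lhf i Om Of c =>
    refine ⟨id, fun _ j O h => ⟨Om, .inr ⟨_, Of, rfl, ?_⟩⟩, .inl fun s b h => ⟨b, h, id⟩,
      fun s b h => ⟨b, h⟩, fun s h => (by cases h), fun _ _ _ => .le hle⟩
    obtain ⟨rfl, h₁, h₂⟩ := h.of_add_obs
    obtain ⟨h₃, h₄⟩ : i = j ∧ phases (lh + lhf) = 0 := by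
      simp only [map_add, LogHeap.phases_single, LogRes.phases] at h₁ ⊢
      exact eq_and_eq_zero_of_add_single h₁
    subst h₃
    simp only [map_add, add_eq_zero, LogHeap.bags_single, LogRes.bags] at h₂ h₄
    simp [LogHeap.Owns, h₂, h₄]
  | consumeItPerm => exact .of_heap_eq id (fun _ _ => Iff.rfl) (by simp) (by simp) (by simpa using hle)
  | alloc | newMutex | assign =>
    refine .of_heap_eq (fun h m P lhP hm => h m P lhP (by simpa using hm)) (by simp) (by simp)
      (by simp) (by simpa using hle)
  | @acquire ah lh e m P lhP f O =>
    refine .of_signals_eq (fun h m P lhP hm => h m P lhP ?_) (fun h i O' hO => ?_) (by simp)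
      fun _ _ _ => .le (by simpa using hle)
    · simp only [Finset.mem_insert, reduceCtorEq, false_or] at hm
      exact Finset.mem_insert_of_mem hm
    · obtain ⟨rfl, h₁, h₂⟩ := hO.of_add_obs
      -- The heap gained from the lock brings no second phase or obligations chunk.
      have h₃ := h _ _ _ (Finset.mem_insert_self _ _)
      simp at h₁ h₂
      exact ⟨_, by simp [LogHeap.Owns, h₁, h₂, h₃.phases_eq, h₃.bags_eq]; rfl, by simp⟩
  | @release ah lh e m P lhP f O _ _ _ hP =>
    refine .of_signals_eq (fun h m P lhP hm => ?_) (fun h i O' hO => ⟨O, ?_⟩) (by simp)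
      fun _ _ _ => .le (by simpa using hle)
    · rcases Finset.mem_insert.1 hm with hm | hm
      · cases hm
        exact hP
      · exact h _ _ _ (Finset.mem_insert_of_mem hm)
    · obtain ⟨rfl, h₁, h₂⟩ := hO.of_add_obs
      simp only [map_add, hP.phases_eq, hP.bags_eq, LogHeap.phases_single, LogHeap.bags_single,
        LogRes.phases, LogRes.bags, add_zero] at h₁ h₂
      simp [LogHeap.Owns, h₁, h₂]
  | _ => exact .of_heap_eq id (fun _ _ => Iff.rfl) rfl rfl le_rfl

theorem GhostStep.exists_stepSpec {t σ} {ah ah' : AnnoHeap.{u, v} U} {atp atp' : AnnoPool.{u, v} U}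
    (h : GhostStep t σ ah atp ah' atp') : ∃ lh c lh', atp.lookup t = some (lh, .run c) ∧
      atp' = atp.insert t (lh', .run c) ∧ StepSpec σ ah lh ah' lh' none := by
  cases h with
  | @newSignal _ _ lh O c id L hid hl =>
    refine ⟨_, _, _, hl, rfl, ⟨fun h m P lhP hm => h m P lhP (by simpa using hm), ?_, ?_, ?_, ?_, ?_⟩⟩
    · intro _ i O' hO
      obtain ⟨rfl, h₁, h₂⟩ := hO.of_add_obs
      exact ⟨_, .inl ⟨rfl, ⟨by simp [h₁], by simp [h₂]; rfl⟩,
        fun s _ h => Nat.lt_add_right _ h⟩⟩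
    · refine .inr ⟨(id, L), hid, fun i O' hO => ?_, fun s b h => ?_⟩
      · obtain ⟨rfl, -⟩ := hO.of_add_obs
        simp [Bag.single_self]
      · simp only [Finset.mem_insert, AnnoRes.signal.injEq] at h
        exact h.imp And.left _root_.id
    · exact fun s b h => ⟨b, Finset.mem_insert_of_mem h⟩
    · exact fun s h => by cases h
    · exact fun i O' _ => .le (by simp [localPerms])
  | @setSignal ah _ lh O c s hs hl =>
    refine ⟨_, _, _, hl, rfl, ⟨fun h m P lhP hm => h m P lhP (by simpa using hm), ?_, ?_, ?_, ?_, ?_⟩⟩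
    · intro _ i O' hO
      obtain ⟨rfl, h₁, h₂⟩ := hO.of_add_obs
      simp at h₁ h₂
      refine ⟨O, .inl ⟨rfl, by simp [LogHeap.Owns, h₁, h₂], fun s' hs' h => ?_⟩⟩
      -- The unset chunk of `s` has left the heap, so a signal that is still unset is not `s` and
      -- its obligation is kept.
      have hne : Ob.ofSignal s' ≠ Ob.ofSignal s := by
        rintro he
        have : s' = s := by
          simp only [Ob.ofSignal, Prod.mk.injEq, Sum.inr.injEq] at he
          exact Prod.ext he.1 he.2
        subst this
        simp [hs] at hs'
      simpa [Bag.single_apply_of_ne hne] using h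
    · refine .inl fun s' b h => ?_
      simp only [Finset.mem_insert, AnnoRes.signal.injEq] at h ⊢
      obtain ⟨rfl, -⟩ | h := h
      · exact ⟨false, .inl ⟨rfl, rfl⟩, fun _ => rfl⟩
      · exact ⟨b, .inr h, id⟩
    · intro s' b h
      simp only [Finset.mem_insert, AnnoRes.signal.injEq] at h ⊢
      obtain ⟨rfl, -⟩ | h := h
      · exact ⟨true, .inl ⟨rfl, rfl⟩⟩
      · exact ⟨b, .inr h⟩
    · exact fun s h => by cases h
    · exact fun i O' _ => .le (by simp [localPerms])
  | @waitPerm _ _ lh c i d d' id hd hl =>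
    refine ⟨_, _, _, hl, rfl, .of_signals_eq _root_.id (fun _ j O h => ⟨O, ?_, fun _ => rfl⟩)
      (fun _ _ => Iff.rfl) fun _ _ _ => .weaken i d {.wait i id d'} ?_ ?_⟩
    · simpa [LogHeap.Owns] using h
    · simpa [Perm.phase, Perm.degree] using hd
    · simp only [localPerms, mult_singleton, map_add, LogHeap.perms_single, LogRes.perms]
      exact le_of_eq (by abel)
  | @wait _ _ lh c i' i O d s hi hO hs hl =>
    refine ⟨_, _, _, hl, rfl, ⟨id, fun _ i O h => ⟨O, .inl ⟨rfl, by simpa [LogHeap.Owns] using h,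
      fun _ _ h => h⟩⟩, .inl fun s b h => ⟨b, h, id⟩, fun s b h => ⟨b, h⟩,
      fun s' h => by cases h; exact hs, fun j O' h => ?_⟩⟩
    have h' : (lh + single (.phase i) + single (.obs O)).Owns j O' := by
      simpa [LogHeap.Owns] using h
    obtain ⟨rfl, h₁, -⟩ := h'.of_add_obs
    simp only [map_add, LogHeap.phases_single, LogRes.phases] at h₁
    obtain ⟨rfl, -⟩ := eq_and_eq_zero_of_add_single h₁
    refine .wait s i' d hi hO ?_ ?_
    · simp [localPerms, ← add_assoc]
    · simp [localPerms, mult_singleton, ← add_assoc]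
  | @specItPerm _ _ lh c d i i' hi hl =>
    refine ⟨_, _, _, hl, rfl, .of_signals_eq id (fun _ j O h => ⟨O, ?_, fun _ => rfl⟩)
      (fun _ _ => Iff.rfl) fun _ _ _ => .spec (.it i d) i' hi ?_⟩
    · simpa [LogHeap.Owns] using h
    · simp only [localPerms, mult_singleton, map_add, LogHeap.perms_single, LogRes.perms,
        Perm.withPhase]
      exact le_of_eq (by abel)
  | @specWaitPerm _ _ lh c id d i i' hi hl =>
    refine ⟨_, _, _, hl, rfl, .of_signals_eq _root_.id (fun _ j O h => ⟨O, ?_, fun _ => rfl⟩)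
      (fun _ _ => Iff.rfl) fun _ _ _ => .spec (.wait i id d) i' hi ?_⟩
    · simpa [LogHeap.Owns] using h
    · simp only [localPerms, mult_singleton, map_add, LogHeap.perms_single, LogRes.perms,
        Perm.withPhase]
      exact le_of_eq (by abel)
  | @weakItPerm _ _ lh c i d d' n hd hl =>
    refine ⟨_, _, _, hl, rfl, .of_signals_eq id (fun _ j O h => ⟨O, ?_, fun _ => rfl⟩)
      (fun _ _ => Iff.rfl) fun _ _ _ => .weaken i d (.replicate n (.it i d')) ?_ ?_⟩
    · simpa only [LogHeap.Owns, map_add, map_nsmul, LogHeap.phases_single, LogHeap.bags_single,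
        LogRes.phases, LogRes.bags, smul_zero] using h
    · intro x hx
      rw [Multiset.eq_of_mem_replicate hx]
      exact ⟨rfl, hd⟩
    · simp only [localPerms, mult_singleton, mult_replicate, map_add, map_nsmul,
        LogHeap.perms_single, LogRes.perms]
      exact le_of_eq (by abel)
  | @mutInit ah _ lh lhP P c l L _ _ hP hl =>
    refine ⟨_, _, _, hl, rfl, .of_heap_eq (fun h m P lhP hm => ?_) (by simp) ?_ ?_ ?_⟩
    · rcases Finset.mem_insert.1 hm with hm | hm
      · cases hm
        exact hP
      · exact h _ _ _ (Finset.mem_insert_of_mem hm)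
    · simp [hP.phases_eq]
    · simp [hP.bags_eq]
    · have := LogHeap.perms_mono (protectedHeap_insert_le ah (.unlocked (l, L) P lhP))
      simp only [AnnoRes.protectedHeap, map_add] at this
      rw [localPerms, localPerms, protectedHeap_insert_uninit]
      simp only [map_add, LogHeap.perms_single, LogRes.perms, add_zero]
      calc _ ≤ perms lhP + perms ah.protectedHeap + perms lh := by gcongr
        _ = _ := by abel
  | newGhostCell w _ hl =>
    exact ⟨_, _, _, hl, rfl, .of_heap_eq id (fun _ _ => Iff.rfl) (by simp) (by simp)
      (by simp [localPerms])⟩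
  | mutateGhostCell _ _ hl =>
    exact ⟨_, _, _, hl, rfl, .of_heap_eq id (fun _ _ => Iff.rfl) (by simp) (by simp)
      (by simp [localPerms])⟩

/-! ## Sums over thread pools -/

theorem PoolOf.freshTID_notMem {X : Type v} (tp : PoolOf U X) : tp.freshTID ∉ tp :=
  (wellFounded_lt (α := U.TID)).min_mem {t | t ∉ tp} tp.exists_fresh

theorem PoolOf.lookup_add_of_mem {X : Type v} {tp : PoolOf U X} {t : U.TID} (h : t ∈ tp)
    (N : Option X) : (tp.add N).lookup t = tp.lookup t := by
  cases N with
  | none => rfl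
  | some n => exact Finmap.lookup_insert_of_ne _ fun he => tp.freshTID_notMem (he ▸ h)

theorem PoolOf.lookup_add_freshTID {X : Type v} (tp : PoolOf U X) (n : X) :
    (tp.add (some n)).lookup tp.freshTID = some n :=
  Finmap.lookup_insert _

theorem PoolOf.lookup_add_eq_some {X : Type v} {tp : PoolOf U X} {t : U.TID} {N : Option X} {x : X}
    (h : (tp.add N).lookup t = some x) :
    tp.lookup t = some x ∨ t = tp.freshTID ∧ N = some x := by
  cases N with
  | none => exact .inl h
  | some n =>
    by_cases ht : t = tp.freshTID
    · subst ht
      rw [PoolOf.lookup_add_freshTID] at h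
      exact .inr ⟨rfl, h⟩
    · exact .inl ((Finmap.lookup_insert_of_ne _ ht).symm.trans h)

section
variable {X : Type v} {M : Type*} [AddCommMonoid M] (g : X → M)

def PoolOf.sum (tp : PoolOf U X) : M := ∑ t ∈ tp.keys, (tp.lookup t).elim 0 g

/-- Sum over all threads but one. -/
def PoolOf.sumOthers (tp : PoolOf U X) (t : U.TID) : M :=
  ∑ t' ∈ tp.keys.erase t, (tp.lookup t').elim 0 g

theorem PoolOf.sum_eq {tp : PoolOf U X} {t : U.TID} {x : X} (h : tp.lookup t = some x) :
    tp.sum g = g x + tp.sumOthers g t := by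
  have ht : t ∈ tp.keys := Finmap.mem_keys.2 (Finmap.mem_of_lookup_eq_some h)
  rw [PoolOf.sum, PoolOf.sumOthers, ← Finset.add_sum_erase _ _ ht, h, Option.elim_some]

theorem PoolOf.sumOthers_insert (tp : PoolOf U X) (t : U.TID) (x : X) :
    PoolOf.sumOthers g (tp.insert t x) t = tp.sumOthers g t := by
  have hk : (Finmap.insert t x tp).keys.erase t = tp.keys.erase t := by
    ext t'
    simp only [Finset.mem_erase, Finmap.mem_keys, Finmap.mem_insert]
    tauto
  rw [PoolOf.sumOthers, PoolOf.sumOthers, hk]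
  exact Finset.sum_congr rfl fun t' ht' => by
    rw [Finmap.lookup_insert_of_ne _ (Finset.ne_of_mem_erase ht')]

theorem PoolOf.sum_insert (tp : PoolOf U X) (t : U.TID) (x : X) :
    PoolOf.sum g (tp.insert t x) = g x + tp.sumOthers g t := by
  rw [PoolOf.sum_eq g (Finmap.lookup_insert tp), PoolOf.sumOthers_insert]

theorem PoolOf.sum_add (tp : PoolOf U X) (N : Option X) :
    (tp.add N).sum g = N.elim 0 g + tp.sum g := by
  cases N with
  | none => simp [PoolOf.add]
  | some n =>
    have h : tp.sumOthers g tp.freshTID = tp.sum g := by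
      rw [PoolOf.sumOthers, Finset.erase_eq_of_notMem fun h =>
        tp.freshTID_notMem (Finmap.mem_keys.1 h), PoolOf.sum]
    rw [PoolOf.add, PoolOf.sum_insert, h, Option.elim_some]

end

/-! ## Steps of configurations -/

/-- All permissions of a configuration. -/
noncomputable def totalPerms (ah : AnnoHeap.{u, v} U) (atp : AnnoPool.{u, v} U) : Perm U → ℚ≥0 :=
  perms (PoolOf.sum Prod.fst atp) + perms ah.protectedHeap

/-- A step of thread `t` from command `c` and heap `lh` to `T'` and `lh'` that starts the
thread `N`. -/
structure Move (t : U.TID) (σ : Option (Signal U)) (ah : AnnoHeap.{u, v} U)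
    (atp : AnnoPool.{u, v} U) (ah' : AnnoHeap.{u, v} U) (atp' : AnnoPool.{u, v} U)
    (lh : LogHeap.{u, v} U) (c : Cmd U) (lh' : LogHeap.{u, v} U) (T' : Thread U)
    (N : Option (AnnoThread.{u, v} U)) : Prop where
  lookup : atp.lookup t = some (lh, .run c)
  pool : atp' = PoolOf.add (atp.insert t (lh', T')) N
  spec : StepSpec σ ah lh ah' lh' (N.map Prod.fst)
  new : ∀ n, N = some n → ∃ c, n.2 = .run c
  term : T' = .term → lh.HasObs 0 ∧ ah' = ah

/-- The stepping thread and the forked thread together have become smaller. -/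
def WeightLt (c : Cmd U) (T' : Thread U) (N : Option (AnnoThread.{u, v} U)) : Prop :=
  T'.weight + N.elim 0 (fun n => n.2.weight) < (Thread.run c).weight

theorem GhostStep.exists_move {t σ} {ah ah' : AnnoHeap.{u, v} U} {atp atp' : AnnoPool.{u, v} U}
    (h : GhostStep t σ ah atp ah' atp') :
    ∃ lh c lh', Move t σ ah atp ah' atp' lh c lh' (.run c) none := by
  obtain ⟨lh, c, lh', h₁, h₂, h₃⟩ := h.exists_stepSpec
  exact ⟨lh, c, lh', h₁, h₂, h₃, by simp, by simp⟩

section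
variable {t : U.TID} {σ : Option (Signal U)} {ah ah' : AnnoHeap.{u, v} U}
  {atp atp' : AnnoPool.{u, v} U} {lh lh' : LogHeap.{u, v} U} {c : Cmd U} {T' : Thread U}
  {N : Option (AnnoThread.{u, v} U)}

theorem Move.totalPerms_eq (h : Move t σ ah atp ah' atp' lh c lh' T' N) :
    totalPerms ah atp = perms (atp.sumOthers Prod.fst t) + localPerms ah lh := by
  rw [totalPerms, PoolOf.sum_eq _ h.lookup, localPerms, map_add]
  abel

theorem Move.totalPerms_eq' (h : Move t σ ah atp ah' atp' lh c lh' T' N) :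
    totalPerms ah' atp' = perms (atp.sumOthers Prod.fst t) +
      (localPerms ah' lh' + perms ((N.map Prod.fst).getD 0)) := by
  rw [totalPerms, h.pool, PoolOf.sum_add, PoolOf.sum_insert, localPerms]
  cases N <;> simp <;> abel

theorem Move.permChange (h : Move t σ ah atp ah' atp' lh c lh' T' N) {i O} (hO : lh.Owns i O) :
    PermChange i O σ (totalPerms ah atp) (totalPerms ah' atp') := by
  rw [h.totalPerms_eq, h.totalPerms_eq']
  exact (h.spec.perms i O hO).add_left _

theorem RealStep.exists_move (h : RealStep t ah atp ah' atp') :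
    ∃ lh c lh' T' N, Move t none ah atp ah' atp' lh c lh' T' N ∧
      ((∀ i O, lh.Owns i O → Consumes i (totalPerms ah atp) (totalPerms ah' atp')) ∨
        WeightLt c T' N) := by
  cases h with
  | @lift lh c _ lh' c' T _ hl h =>
    have hm : Move t none ah atp ah' (PoolOf.add (atp.insert t (lh', .run c'))
        (T.map fun p => (p.1, .run p.2))) lh c lh' (.run c') (T.map fun p => (p.1, .run p.2)) := by
      refine ⟨hl, rfl, ?_, ?_, by simp⟩
      · have := h.stepSpec
        rw [Option.map_map]
        exact this
      · intro n hn
        obtain ⟨p, -, rfl⟩ := Option.map_eq_some_iff.1 hn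
        exact ⟨_, rfl⟩
    refine ⟨_, _, _, _, _, hm, h.consumes_or_weight_lt.2.imp (fun h i O hO => ?_) fun h => ?_⟩
    · rw [hm.totalPerms_eq, hm.totalPerms_eq', Option.map_map]
      exact (h i O hO).add_left _
    · cases T <;> simp_all [WeightLt, Thread.weight]
      omega
  | @term lh e w _ hl he hO =>
    exact ⟨_, _, _, _, none, ⟨hl, rfl, .of_heap_eq id (fun _ _ => Iff.rfl) rfl rfl le_rfl, by simp,
      fun _ => ⟨hO, rfl⟩⟩, .inr (by simp [WeightLt, Thread.weight])⟩

/-- The last alternative accounts for ghost steps, which keep the command and fork nothing. -/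
theorem AnnoStep.exists_move (h : AnnoStep t σ ah atp ah' atp') :
    ∃ lh c lh' T' N, Move t σ ah atp ah' atp' lh c lh' T' N ∧
      ((∀ i O, lh.Owns i O → Consumes i (totalPerms ah atp) (totalPerms ah' atp')) ∨
        WeightLt c T' N ∨ T' = .run c ∧ N = none) := by
  rcases h with h | ⟨rfl, h⟩
  · obtain ⟨lh, c, lh', h⟩ := h.exists_move
    exact ⟨lh, c, lh', _, _, h, .inr (.inr ⟨rfl, rfl⟩)⟩
  · obtain ⟨lh, c, lh', T', N, h, h'⟩ := h.exists_move
    exact ⟨lh, c, lh', T', N, h, h'.imp_right .inl⟩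

theorem Move.lookup_self (h : Move t σ ah atp ah' atp' lh c lh' T' N) :
    atp'.lookup t = some (lh', T') := by
  rw [h.pool, PoolOf.lookup_add_of_mem (Finmap.mem_insert.2 (.inl rfl)), Finmap.lookup_insert]

theorem Move.lookup_of_ne (h : Move t σ ah atp ah' atp' lh c lh' T' N) {t' x} (ht : t' ≠ t)
    (hx : atp.lookup t' = some x) : atp'.lookup t' = some x := by
  rw [h.pool, PoolOf.lookup_add_of_mem (Finmap.mem_insert.2 (.inr
    (Finmap.mem_of_lookup_eq_some hx))), Finmap.lookup_insert_of_ne _ ht, hx]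

theorem Move.lookup_new {n} (h : Move t σ ah atp ah' atp' lh c lh' T' (some n)) :
    ∃ t', atp'.lookup t' = some n :=
  ⟨_, h.pool ▸ PoolOf.lookup_add_freshTID _ _⟩

theorem Move.lookup_cases (h : Move t σ ah atp ah' atp' lh c lh' T' N) {t' x}
    (hx : atp'.lookup t' = some x) :
    (t' ≠ t ∧ atp.lookup t' = some x) ∨ (t' = t ∧ x = (lh', T')) ∨
      t' ≠ t ∧ t' = PoolOf.freshTID (atp.insert t (lh', T')) ∧ N = some x := by
  by_cases ht : t' = t
  · subst ht
    rw [h.lookup_self] at hx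
    exact .inr (.inl ⟨rfl, (Option.some.inj hx).symm⟩)
  · rw [h.pool] at hx
    rcases PoolOf.lookup_add_eq_some hx with hx | hx
    · exact .inl ⟨ht, (Finmap.lookup_insert_of_ne _ ht).symm.trans hx⟩
    · exact .inr (.inr ⟨ht, hx⟩)

/-! ## Invariants -/

/-- A running thread with phase `i` holds an obligation to set the signal `s`. -/
def Holds (atp : AnnoPool.{u, v} U) (s : Signal U) (t : U.TID) (i : PhaseID) : Prop :=
  ∃ lh c O, atp.lookup t = some (lh, .run c) ∧ lh.Owns i O ∧ 0 < O (.ofSignal s)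

/-- Phases are the leaves of a binary tree of forks, so those of distinct threads are incomparable;
terminated threads keep theirs. Since wait permissions mention only IDs, `signal_unique` is needed
to count waits by ID. By `holds`, an unset signal always has a running debtor. -/
structure Inv (ah : AnnoHeap.{u, v} U) (atp : AnnoPool.{u, v} U) : Prop where
  locks : ah.LocksPure
  owns : ∀ t lh T, atp.lookup t = some (lh, T) → ∃ i O, lh.Owns i O
  incomparable : ∀ t₁ t₂ x₁ x₂ i₁ i₂ O₁ O₂, t₁ ≠ t₂ → atp.lookup t₁ = some x₁ →
    atp.lookup t₂ = some x₂ → x₁.1.Owns i₁ O₁ → x₂.1.Owns i₂ O₂ → ¬ i₁ <+: i₂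
  signal_unique : ∀ s₁ s₂ b₁ b₂, .signal s₁ b₁ ∈ ah → .signal s₂ b₂ ∈ ah → s₁.1 = s₂.1 → s₁ = s₂
  holds : ∀ s, .signal s false ∈ ah → ∃ t i, Holds atp s t i

/-- The obligation to set a signal survives a step of its holder, unless the signal is set. -/
theorem Move.exists_holds (h : Move t σ ah atp ah' atp' lh c lh' T' N) (hah : ah.LocksPure)
    {i s} (hs : .signal s false ∈ ah') (ht : Holds atp s t i) :
    ∃ t' i', Holds atp' s t' i' ∧ i <+: i' ∧
      ((atp'.lookup t').elim 0 fun x => x.2.weight) ≤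
        T'.weight + N.elim 0 (fun n => n.2.weight) ∧ (N = none → t' = t) := by
  obtain ⟨lh₁, c₁, O, hl, hO, hpos⟩ := ht
  rw [h.lookup] at hl
  cases hl
  obtain ⟨c', rfl⟩ : ∃ c', T' = .run c' := by
    cases T' with
    | run c' => exact ⟨c', rfl⟩
    -- A terminating thread has the empty bag and cannot be the holder.
    | term =>
      have h₁ : bags lh 0 = 1 := (h.term rfl).1.2
      rw [hO.2, Pi.single_apply] at h₁
      split_ifs at h₁ with h₂
      · subst h₂
        cases hpos
      · simp at h₁
  obtain ⟨O', ⟨hN, hO', hs'⟩ | ⟨n, Of, hN, hO', hOf, rfl⟩⟩ := h.spec.owns hah i O hO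
  · exact ⟨t, i, ⟨_, _, _, h.lookup_self, hO', hs' s hs hpos⟩, List.prefix_rfl,
      by simp [h.lookup_self], fun _ => rfl⟩
  · obtain ⟨n, rfl, rfl⟩ := Option.map_eq_some_iff.1 hN
    -- The forked bag is `O' + Of`, so at least one of the two threads inherits the obligation.
    by_cases hpos' : 0 < O' (.ofSignal s)
    · exact ⟨t, _, ⟨_, _, _, h.lookup_self, hO', hpos'⟩, List.prefix_append _ _,
        by simp [h.lookup_self], fun _ => rfl⟩
    · obtain ⟨t', ht'⟩ := h.lookup_new
      obtain ⟨c'', hc''⟩ := h.new n rfl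
      refine ⟨t', _, ⟨n.1, c'', Of, ?_, hOf, ?_⟩, List.prefix_append _ _, by simp [ht'], by simp⟩
      · rw [ht', ← hc'']
      · simp only [Pi.add_apply] at hpos
        omega

/-- A phase that is not inherited unchanged from another thread extends the phase of the acting
thread by at most one letter; the data about `t'` tell forker and forkee apart. -/
theorem Move.phase_cases (h : Move t σ ah atp ah' atp' lh c lh' T' N) (hinv : Inv ah atp)
    {t' x} (hx : atp'.lookup t' = some x) :
    (t' ≠ t ∧ atp.lookup t' = some x) ∨ ∃ i j O O', lh.Owns i O ∧ x.1.Owns (i ++ j) O' ∧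
      (j = [] ∧ N = none ∧ t' = t ∨ j = [.forker] ∧ t' = t ∨
        j = [.forkee] ∧ t' ≠ t ∧ t' = PoolOf.freshTID (atp.insert t (lh', T'))) := by
  obtain ⟨i, O, hO⟩ := hinv.owns _ _ _ h.lookup
  rcases h.lookup_cases hx with hx | ⟨rfl, rfl⟩ | ⟨hne, hf, rfl⟩
  · exact .inl hx
  · obtain ⟨O', ⟨hN, hO', -⟩ | ⟨n, Of, hN, hO', -, -⟩⟩ := h.spec.owns hinv.locks i O hO
    · exact .inr ⟨i, [], O, O', hO, by simpa using hO', .inl ⟨rfl, by simpa using hN, rfl⟩⟩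
    · exact .inr ⟨i, _, O, O', hO, hO', .inr (.inl ⟨rfl, rfl⟩)⟩
  · obtain ⟨O', ⟨hN, -⟩ | ⟨n, Of, hN, -, hOf, -⟩⟩ := h.spec.owns hinv.locks i O hO
    · cases hN
    · cases hN
      exact .inr ⟨i, _, O, Of, hO, hOf, .inr (.inr ⟨rfl, hne, hf⟩)⟩

/-- For incomparability, a new phase extends the old phase of the acting thread, which was
incomparable to those of the others, and forker and forkee differ in their last letter. -/
theorem Move.inv (h : Move t σ ah atp ah' atp' lh c lh' T' N) (hinv : Inv ah atp) :
    Inv ah' atp' where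
  locks := h.spec.locks hinv.locks
  owns t' lh₁ T hl := by
    rcases h.phase_cases hinv hl with ⟨-, hl⟩ | ⟨i, j, O, O', -, hO, -⟩
    · exact hinv.owns _ _ _ hl
    · exact ⟨_, _, hO⟩
  incomparable t₁ t₂ x₁ x₂ i₁ i₂ O₁ O₂ hne h₁ h₂ ho₁ ho₂ hpre := by
    rcases h.phase_cases hinv h₁ with ⟨hn₁, hl₁⟩ | ⟨i, j, O, O', hO, hx, hc⟩ <;>
    rcases h.phase_cases hinv h₂ with ⟨hn₂, hl₂⟩ | ⟨k, l, B, B', hB, hy, hd⟩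
    · exact hinv.incomparable _ _ _ _ _ _ _ _ hne hl₁ hl₂ ho₁ ho₂ hpre
    · obtain ⟨rfl, -⟩ := ho₂.unique hy
      -- Two prefixes of one word are comparable, so the old phases would have been comparable
      -- already.
      rcases List.prefix_or_prefix_of_prefix hpre (List.prefix_append k l) with h' | h'
      · exact hinv.incomparable _ _ _ _ _ _ _ _ hn₁ hl₁ h.lookup ho₁ hB h'
      · exact hinv.incomparable _ _ _ _ _ _ _ _ hn₁.symm h.lookup hl₁ hB ho₁ h'
    · obtain ⟨rfl, -⟩ := ho₁.unique hx
      exact hinv.incomparable _ _ _ _ _ _ _ _ hn₂.symm h.lookup hl₂ hO ho₂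
        ((List.prefix_append i j).trans hpre)
    · obtain ⟨rfl, -⟩ := ho₁.unique hx
      obtain ⟨rfl, -⟩ := ho₂.unique hy
      obtain ⟨rfl, -⟩ := hO.unique hB
      rw [List.prefix_append_right_inj] at hpre
      rcases hc with ⟨rfl, hN, rfl⟩ | ⟨rfl, rfl⟩ | ⟨rfl, hc, hf⟩ <;>
      rcases hd with ⟨rfl, hN', rfl⟩ | ⟨rfl, rfl⟩ | ⟨rfl, hd, hf'⟩ <;> simp_all
      -- What remains is an acting thread that keeps its phase while another thread sits at the
      -- fresh ID; but nothing was forked, so this ID is unused.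
      subst hN
      rw [h.pool] at h₂
      have hm := Finmap.mem_of_lookup_eq_some h₂
      rw [hf'] at hm
      exact PoolOf.freshTID_notMem _ hm
  signal_unique s₁ s₂ b₁ b₂ h₁ h₂ he := by
    rcases h.spec.signals with hs | ⟨s₀, hs₀, -, hs⟩
    · obtain ⟨b, hb, -⟩ := hs _ _ h₁
      obtain ⟨b', hb', -⟩ := hs _ _ h₂
      exact hinv.signal_unique _ _ _ _ hb hb' he
    · rcases hs _ _ h₁ with rfl | h₁ <;> rcases hs _ _ h₂ with rfl | h₂
      · rfl
      · exact absurd ⟨s₂.2, b₂, he ▸ h₂⟩ hs₀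
      · exact absurd ⟨s₁.2, b₁, he ▸ h₁⟩ hs₀
      · exact hinv.signal_unique _ _ _ _ h₁ h₂ he
  holds s hs := by
    have key (hs' : .signal s false ∈ ah) : ∃ t i, Holds atp' s t i := by
      obtain ⟨t', i, ht'⟩ := hinv.holds s hs'
      by_cases hne : t' = t
      · subst hne
        obtain ⟨t'', i', ht'', -⟩ := h.exists_holds hinv.locks hs ht'
        exact ⟨t'', i', ht''⟩
      · obtain ⟨lh₁, c₁, O, hl, hO⟩ := ht'
        exact ⟨t', i, lh₁, c₁, O, h.lookup_of_ne hne hl, hO⟩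
    rcases h.spec.signals with hs' | ⟨s₀, hs₀, ho, hs'⟩
    · obtain ⟨b, hb, hb'⟩ := hs' _ _ hs
      exact key (hb' rfl ▸ hb)
    · rcases hs' _ _ hs with rfl | hs'
      · cases T' with
        -- Termination leaves the annotated heap unchanged and thus creates no signal.
        | term => exact absurd ⟨_, _, (h.term rfl).2 ▸ hs⟩ hs₀
        | run c' =>
          obtain ⟨i, O, hO⟩ := hinv.owns _ _ _ h.lookup
          obtain ⟨O', ⟨-, hO', -⟩ | ⟨-, -, -, hO', -⟩⟩ := h.spec.owns hinv.locks i O hO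
          · exact ⟨t, _, _, _, _, h.lookup_self, hO', ho _ _ hO'⟩
          · exact ⟨t, _, _, _, _, h.lookup_self, hO', ho _ _ hO'⟩
      · exact key hs'

end

/-! ## Permissions can be consumed only finitely often along a path of phases -/

section
variable {D : Type*} [Preorder D] [WellFoundedLT D]

instance : IsWellFounded (Multiset D) Multiset.IsDershowitzMannaLT :=
  ⟨Multiset.wellFounded_isDershowitzMannaLT⟩

/-- The rank of a multiset in the Dershowitz-Manna order. -/
noncomputable def multisetRank (M : Multiset D) : Ordinal :=
  IsWellFounded.rank Multiset.IsDershowitzMannaLT M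

theorem multisetRank_add_lt {Y : Multiset D} {d : D} (X : Multiset D) (h : ∀ y ∈ Y, y < d) :
    multisetRank (X + Y) < multisetRank (X + {d}) :=
  IsWellFounded.rank_lt_of_rel
    ⟨X, Y, {d}, by simp, rfl, rfl, fun y hy => ⟨d, by simp, h y hy⟩⟩

theorem multisetRank_mono {M N : Multiset D} (h : M ≤ N) : multisetRank M ≤ multisetRank N := by
  obtain ⟨Z, rfl⟩ := Multiset.le_iff_exists_add.1 h
  by_cases hZ : Z = 0
  · simp [hZ]
  · exact (IsWellFounded.rank_lt_of_rel ⟨M, 0, Z, hZ, by simp, rfl, by simp⟩).le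

end

/-- The degrees of the iteration permissions that a permission may still give rise to, if `W id`
bounds the number of waits for the signal `id`. -/
def Perm.credit (W : U.ID → ℕ) : Perm U → Multiset U.Degree
  | .it _ d => {d}
  | .wait _ id d => .replicate (W id) d

def credit (W : U.ID → ℕ) (B : Multiset (Perm U)) : Multiset U.Degree := B.bind (Perm.credit W)

theorem credit_cons (W : U.ID → ℕ) (p : Perm U) (B : Multiset (Perm U)) :
    credit W (p ::ₘ B) = credit W B + p.credit W := by
  rw [credit, Multiset.cons_bind, add_comm, credit]

theorem credit_add (W : U.ID → ℕ) (B C : Multiset (Perm U)) :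
    credit W (B + C) = credit W B + credit W C :=
  Multiset.add_bind ..

theorem Perm.credit_mono {W W' : U.ID → ℕ} (h : W ≤ W') (p : Perm U) : p.credit W ≤ p.credit W' := by
  cases p with
  | it => exact le_rfl
  | wait i id d => exact Multiset.replicate_le_replicate _ |>.2 (h id)

theorem credit_mono {W W' : U.ID → ℕ} (h : W ≤ W') (B : Multiset (Perm U)) :
    credit W B ≤ credit W' B := by
  induction B using Multiset.induction with
  | empty => exact le_rfl
  | cons p B ih => rw [credit_cons, credit_cons]; exact add_le_add ih (p.credit_mono h)

theorem Perm.eq_degree_of_mem_credit {W : U.ID → ℕ} {p : Perm U} {d} (h : d ∈ p.credit W) :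
    d = p.degree := by
  cases p with
  | it => exact Multiset.mem_singleton.1 h
  | wait => exact Multiset.eq_of_mem_replicate h

/-- The multiset `B` bounds the permissions with phases in `Φ`. -/
def Bounds (Φ : Set PhaseID) (tot : Perm U → ℚ≥0) (B : Multiset (Perm U)) : Prop :=
  ∀ p, p.phase ∈ Φ → tot p ≤ mult B p

/-- Chunks may be split into fractions, so totals are rational; the multiset bound is integral,
which turns a full chunk into an element. -/
theorem Bounds.exists_cons {Φ : Set PhaseID} {tot : Perm U → ℚ≥0} {B} (h : Bounds Φ tot B)
    {p : Perm U} (hp : p.phase ∈ Φ) (h1 : 1 ≤ tot p) : ∃ B₀, B = p ::ₘ B₀ := by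
  refine Multiset.exists_cons_of_mem (Multiset.one_le_count_iff_mem.1 ?_)
  have := h1.trans (h p hp)
  unfold mult at this
  exact_mod_cast this

theorem mult_self (p : Perm U) : mult {p} p = 1 := by simp [mult]

theorem mult_eq_zero {X : Multiset (Perm U)} {p : Perm U} (h : p ∉ X) : mult X p = 0 := by
  simp [mult, Multiset.count_eq_zero_of_notMem h]

/-- The bound undergoes the same exchange as the total. Adding `mult {p}` on the left and cancelling
avoids subtraction of nonnegative rationals. -/
theorem Bounds.exchange {Φ : Set PhaseID} {tot tot' : Perm U → ℚ≥0} {B₀ X : Multiset (Perm U)}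
    {p : Perm U} (h : Bounds Φ tot (p ::ₘ B₀)) (hle : tot' + mult {p} ≤ tot + mult X) :
    Bounds Φ tot' (B₀ + X) := by
  intro q hq
  have h₁ := h q hq
  have h₂ := hle q
  rw [mult_cons] at h₁
  rw [mult_add]
  simp only [Pi.add_apply] at h₁ h₂ ⊢
  have : tot' q + mult {p} q ≤ mult B₀ q + mult X q + mult {p} q := by
    calc _ ≤ _ := h₂
      _ ≤ mult B₀ q + mult {p} q + mult X q := by gcongr
      _ = _ := by ring
  exact le_of_add_le_add_right this

/-- The consumed permission belongs to an ancestor of `i`, hence to `Φ`, so it is counted by `B`;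
dropping its degree strictly lowers the rank. -/
theorem Bounds.of_consumes {Φ : Set PhaseID} (hΦ : ∀ i j, i <+: j → j ∈ Φ → i ∈ Φ)
    {tot tot' : Perm U → ℚ≥0} {B i} (h : Bounds Φ tot B) (hi : i ∈ Φ) (hc : Consumes i tot tot')
    {W W' : U.ID → ℕ} (hW : W' ≤ W) :
    ∃ B', Bounds Φ tot' B' ∧ multisetRank (credit W' B') < multisetRank (credit W B) := by
  obtain ⟨i', d, hi', hle⟩ := hc
  have h1 : 1 ≤ tot (.it i' d) := by
    have := hle (.it i' d)
    simp only [Pi.add_apply, Pi.single_eq_same] at this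
    exact (le_add_of_nonneg_left zero_le).trans this
  obtain ⟨B₀, rfl⟩ := h.exists_cons (p := .it i' d) (hΦ _ _ hi' hi) h1
  refine ⟨B₀, ?_, ?_⟩
  · have := h.exchange (X := 0) (tot' := tot') (by
      rw [mult_singleton]
      exact hle.trans (le_add_of_nonneg_right fun _ => zero_le))
    simpa using this
  · rw [credit_cons]
    refine (multisetRank_mono (credit_mono hW B₀)).trans_lt ?_
    have := multisetRank_add_lt (Y := 0) (d := d) (credit W B₀) (by simp)
    rwa [add_zero] at this

/-- Weakening is a Dershowitz-Manna descent. Extending a phase can leave `Φ` but not enter it. A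
wait in `Φ` adds one copy of `d`, while the wait permission that justifies it loses at least one
copy because `W' s.1 < W s.1`. Changes outside `Φ` are not counted. -/
theorem Bounds.of_permChange {Φ : Set PhaseID} (hΦ : ∀ i j, i <+: j → j ∈ Φ → i ∈ Φ)
    {tot tot' : Perm U → ℚ≥0} {B i O σ} (h : Bounds Φ tot B) (hc : PermChange i O σ tot tot')
    {W W' : U.ID → ℕ} (hW : W' ≤ W) (hσ : ∀ s, σ = some s → i ∈ Φ → W' s.1 < W s.1) :
    ∃ B', Bounds Φ tot' B' ∧ multisetRank (credit W' B') ≤ multisetRank (credit W B) := by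
  have hB := multisetRank_mono (credit_mono hW B)
  cases hc with
  | le hle => exact ⟨B, fun p hp => (hle p).trans (h p hp), hB⟩
  | weaken j d X hX hle =>
    by_cases hp : j ∈ Φ
    · have hpX : Perm.it j d ∉ X := fun hm => lt_irrefl _ (hX _ hm).2
      have h1 : 1 ≤ tot (.it j d) := by
        have := hle (.it j d)
        simp only [Pi.add_apply, mult_self, mult_eq_zero hpX, add_zero] at this
        exact (le_add_of_nonneg_left zero_le).trans this
      obtain ⟨B₀, rfl⟩ := h.exists_cons (p := .it j d) hp h1
      refine ⟨B₀ + X, h.exchange hle, ?_⟩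
      rw [credit_add, credit_cons]
      refine (multisetRank_mono (add_le_add_left (credit_mono hW B₀) _)).trans
        (multisetRank_add_lt _ fun y hy => ?_).le
      obtain ⟨x, hx, hy⟩ := Multiset.mem_bind.1 hy
      exact x.eq_degree_of_mem_credit hy ▸ (hX x hx).2
    · refine ⟨B, fun q hq => le_trans ?_ (h q hq), hB⟩
      have hqX : q ∉ X := fun hm => hp ((hX q hm).1 ▸ hq)
      have := hle q
      simp only [Pi.add_apply, mult_eq_zero hqX, add_zero] at this
      exact (le_add_of_nonneg_right zero_le).trans this
  | spec p j hj hle =>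
    by_cases hjΦ : j ∈ Φ
    · by_cases hpj : p.withPhase j = p
      · rw [hpj] at hle
        exact ⟨B, fun q hq => (le_of_add_le_add_right hle q).trans (h q hq), hB⟩
      · have h1 : 1 ≤ tot p := by
          have := hle p
          rw [Pi.add_apply, Pi.add_apply, mult_self,
            mult_eq_zero (by simpa [eq_comm] using hpj), add_zero] at this
          exact (le_add_of_nonneg_left zero_le).trans this
        obtain ⟨B₀, rfl⟩ := h.exists_cons (hΦ _ _ hj hjΦ) h1
        refine ⟨B₀ + {p.withPhase j}, h.exchange hle, le_trans (le_of_eq ?_) hB⟩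
        rw [add_comm, Multiset.singleton_add, credit_cons, credit_cons]
        cases p <;> rfl
    · refine ⟨B, fun q hq => le_trans ?_ (h q hq), hB⟩
      have hqX : q ∉ ({p.withPhase j} : Multiset (Perm U)) := by
        rw [Multiset.mem_singleton]
        rintro rfl
        exact hjΦ (by cases p <;> exact hq)
      have := hle q
      simp only [Pi.add_apply, mult_eq_zero hqX, add_zero] at this
      exact (le_add_of_nonneg_right zero_le).trans this
  | wait s i' d hi' _ h1 hle =>
    by_cases hi : i ∈ Φ
    · have hb : Bounds Φ tot' (.it i d ::ₘ B) := fun q hq => by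
        rw [mult_cons]
        exact (hle q).trans (add_le_add_left (h q hq) _)
      refine ⟨_, hb, ?_⟩
      obtain ⟨B₀, rfl⟩ := h.exists_cons (p := .wait i' s.1 d) (hΦ _ _ hi' hi) h1
      refine multisetRank_mono ?_
      rw [credit_cons, credit_cons, credit_cons, add_assoc]
      refine add_le_add (credit_mono hW _) ?_
      rw [Perm.credit, Perm.credit, Perm.credit, ← Multiset.replicate_one, ← Multiset.replicate_add,
        Multiset.replicate_le_replicate]
      exact hσ s rfl hi
    · refine ⟨B, fun q hq => le_trans ?_ (h q hq), hB⟩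
      have hqX : q ∉ ({.it i d} : Multiset (Perm U)) := by
        rw [Multiset.mem_singleton]
        rintro rfl
        exact hi hq
      have := hle q
      simpa only [Pi.add_apply, mult_eq_zero hqX, add_zero] using this

section
variable {tot : ℕ → Perm U → ℚ≥0} {ph : ℕ → PhaseID} {bg : ℕ → Bag (Ob U)}
  {σ : ℕ → Option (Signal U)}

/-- The rank argument starts at a later time and needs some finite bound there. Only existence
matters, so arbitrary weights with `W' < W` serve: 0 and 1. -/
theorem exists_bounds (hstep : ∀ k, PermChange (ph k) (bg k) (σ k) (tot k) (tot (k + 1)))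
    (h0 : ∃ B, tot 0 ≤ mult B) (k : ℕ) : ∃ B, Bounds Set.univ (tot k) B := by
  induction k with
  | zero => exact h0.imp fun B h p _ => h p
  | succ k ih =>
    obtain ⟨B, hB⟩ := ih
    obtain ⟨B', hB', -⟩ := hB.of_permChange (fun _ _ _ _ => trivial) (hstep k) (W := 1) (W' := 0)
      zero_le_one (fun _ _ _ => one_pos)
    exact ⟨B', hB'⟩

/-- If every signal is waited for only finitely often in the phases `Φ` then permissions are
consumed only finitely often in these phases. -/
theorem eventually_not_consumes
    (hstep : ∀ k, PermChange (ph k) (bg k) (σ k) (tot k) (tot (k + 1)))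
    (h0 : ∃ B, tot 0 ≤ mult B) {Φ : Set PhaseID} (hΦ : ∀ i j, i <+: j → j ∈ Φ → i ∈ Φ) (k₀ : ℕ)
    (hfin : ∀ id, {j | k₀ ≤ j ∧ ph j ∈ Φ ∧ ∃ s, σ j = some s ∧ s.1 = id}.Finite) :
    ∃ K, k₀ ≤ K ∧ ∀ k, K ≤ k → ∀ i ∈ Φ, ¬ Consumes i (tot k) (tot (k + 1)) := by
  -- The waits for `id` in `Φ` that are still to come at time `k`; their number `W k id` drops
  -- exactly when one of them is performed.
  let S (k : ℕ) (id : U.ID) : Set ℕ := {j | k ≤ j ∧ ph j ∈ Φ ∧ ∃ s, σ j = some s ∧ s.1 = id}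
  let W (k : ℕ) (id : U.ID) : ℕ := (S k id).ncard
  have hS {k} (hk : k₀ ≤ k) (id : U.ID) : (S k id).Finite :=
    (hfin id).subset fun j hj => ⟨hk.trans hj.1, hj.2⟩
  have hW {k} (hk : k₀ ≤ k) : W (k + 1) ≤ W k := fun id =>
    Set.ncard_le_ncard (fun j hj => ⟨(Nat.le_succ k).trans hj.1, hj.2⟩) (hS hk id)
  have hW' {k} (hk : k₀ ≤ k) (s : Signal U) (hs : σ k = some s) (hi : ph k ∈ Φ) :
      W (k + 1) s.1 < W k s.1 := by
    refine Set.ncard_lt_ncard ⟨fun j hj => ⟨(Nat.le_succ k).trans hj.1, hj.2⟩, fun hsub => ?_⟩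
      (hS hk s.1)
    have := (hsub (show k ∈ S k s.1 from ⟨le_rfl, hi, s, hs, rfl⟩)).1
    omega
  have hmono {k} (hk : k₀ ≤ k) {B} (hB : Bounds Φ (tot k) B) (n : ℕ) :
      ∃ B', Bounds Φ (tot (k + n)) B' ∧
        multisetRank (credit (W (k + n)) B') ≤ multisetRank (credit (W k) B) := by
    induction n with
    | zero => exact ⟨B, hB, le_rfl⟩
    | succ n ih =>
      obtain ⟨B₁, hB₁, hr⟩ := ih
      have hkn : k₀ ≤ k + n := by omega
      obtain ⟨B₂, hB₂, hr₂⟩ := hB₁.of_permChange hΦ (hstep (k + n)) (hW hkn) (hW' hkn)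
      exact ⟨B₂, hB₂, hr₂.trans hr⟩
  -- Well-founded induction on the rank of the credit: any further consumption leads to a bound of
  -- smaller rank.
  have key (o : Ordinal) : ∀ k B, k₀ ≤ k → Bounds Φ (tot k) B →
      multisetRank (credit (W k) B) = o →
      ∃ K, k₀ ≤ K ∧ ∀ k, K ≤ k → ∀ i ∈ Φ, ¬ Consumes i (tot k) (tot (k + 1)) := by
    induction o using WellFoundedLT.induction with
    | ind o ih =>
      rintro k B hk hB rfl
      by_cases hc : ∀ k', k ≤ k' → ∀ i ∈ Φ, ¬ Consumes i (tot k') (tot (k' + 1))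
      · exact ⟨k, hk, hc⟩
      · push Not at hc
        obtain ⟨k', hk', i, hi, hc⟩ := hc
        obtain ⟨n, rfl⟩ := Nat.exists_eq_add_of_le hk'
        obtain ⟨B₁, hB₁, hr⟩ := hmono hk hB n
        have hkn : k₀ ≤ k + n := by omega
        obtain ⟨B₂, hB₂, hr₂⟩ := hB₁.of_consumes hΦ hi hc (hW hkn)
        exact ih _ (hr₂.trans_le hr) _ B₂ (hkn.trans (Nat.le_succ _)) hB₂ rfl
  obtain ⟨B, hB⟩ := exists_bounds hstep h0 k₀
  exact key _ k₀ B le_rfl (fun p _ => hB p trivial) rfl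

end

/-! ## The initial configuration -/

theorem LogRes.exists_perms_le (r : LogRes.{u, v} U) : ∃ B, r.perms ≤ mult B := by
  cases r with
  | itPerm i d => exact ⟨{.it i d}, by simp [mult_singleton]⟩
  | waitPerm i id d => exact ⟨{.wait i id d}, by simp [mult_singleton]⟩
  | _ => exact ⟨0, fun _ => zero_le⟩

theorem LogHeap.exists_perms_ofMultiset_le (rs : List (LogRes.{u, v} U)) :
    ∃ B, perms (ofMultiset rs) ≤ mult B := by
  induction rs with
  | nil => exact ⟨0, fun _ => zero_le⟩
  | cons r rs ih =>
    obtain ⟨B, hB⟩ := ih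
    obtain ⟨B', hB'⟩ := r.exists_perms_le
    refine ⟨B' + B, ?_⟩
    rw [ofMultiset, List.map_cons, List.sum_cons, map_add, mult_add, perms_single]
    exact add_le_add hB' hB

/-- Lets one permission bound serve both readings of the initial heap. -/
theorem LogHeap.ofSet_le_ofMultiset (rs : List (LogRes.{u, v} U)) : ofSet rs ≤ ofMultiset rs := by
  induction rs with
  | nil => intro r; simp [ofSet]
  | cons r rs ih =>
    intro q
    have h := ih q
    rw [ofMultiset, List.map_cons, List.sum_cons, Pi.add_apply]
    by_cases hq : q = r
    · subst hq
      simp [ofSet, single]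
    · refine le_trans (le_of_eq ?_) (h.trans (le_add_of_nonneg_left zero_le))
      simp [ofSet, hq]

theorem owns_ofSet_initialResources (i₀ : PhaseID) {n : ℕ} (d : Fin n → U.Degree) :
    (LogHeap.ofSet (initialResources.{u, v} i₀ d)).Owns i₀ 0 := by
  constructor <;> funext x <;>
    simp [phases, bags, LogHeap.ofSet, initialResources, List.mem_ofFn, Pi.single_apply]

theorem owns_ofMultiset_initialResources (i₀ : PhaseID) {n : ℕ} (d : Fin n → U.Degree) :
    (LogHeap.ofMultiset (initialResources.{u, v} i₀ d)).Owns i₀ 0 := by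
  constructor <;>
    simp [LogHeap.ofMultiset, initialResources, List.map_ofFn, List.sum_ofFn]

theorem Inv.initial (t₀ : U.TID) {lh : LogHeap.{u, v} U} {i O} (h : lh.Owns i O) (T : Thread U) :
    Inv ∅ (Finmap.singleton t₀ (lh, T)) := by
  have hl {t x} (hx : (Finmap.singleton t₀ (lh, T) : AnnoPool U).lookup t = some x) :
      t = t₀ ∧ x = (lh, T) := by
    have ht : t = t₀ := Finmap.mem_singleton _ _ _ |>.1 (Finmap.mem_of_lookup_eq_some hx)
    subst ht
    rw [Finmap.lookup_singleton_eq] at hx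
    exact ⟨rfl, (Option.some.inj hx).symm⟩
  refine ⟨by simp [AnnoHeap.LocksPure], fun t lh' T' hx => ?_, ?_, by simp, by simp⟩
  · cases (hl hx).2
    exact ⟨i, O, h⟩
  · intro t₁ t₂ x₁ x₂ i₁ i₂ O₁ O₂ hne h₁ h₂
    exact absurd ((hl h₁).1.trans (hl h₂).1.symm) hne

/-! ## Fair infinite reduction sequences -/

/-- Dependent choice with an invariant `P`, used to follow an obligation through time. -/
theorem exists_chain {α : Type*} (P : ℕ → α → Prop) (R : ℕ → α → α → Prop) (h0 : ∃ a, P 0 a)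
    (h : ∀ n a, P n a → ∃ b, P (n + 1) b ∧ R n a b) :
    ∃ f : ℕ → α, ∀ n, P n (f n) ∧ R n (f n) (f (n + 1)) := by
  obtain ⟨a, ha⟩ := h0
  choose g hg using h
  let F (n : ℕ) : {a // P n a} :=
    Nat.rec (motive := fun n => {a // P n a}) ⟨a, ha⟩ (fun n p => ⟨g n p.1 p.2, (hg n p.1 p.2).1⟩) n
  exact ⟨fun n => (F n).1, fun n => ⟨(F n).2, (hg n (F n).1 (F n).2).2⟩⟩

section
variable {ah : ℕ → AnnoHeap.{u, v} U} {atp : ℕ → AnnoPool.{u, v} U} {σ : ℕ → Option (Signal U)}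
  {t : ℕ → U.TID}

theorem inv_of_steps (hstep : ∀ k, AnnoStep (t k) (σ k) (ah k) (atp k) (ah (k + 1)) (atp (k + 1)))
    (h0 : Inv (ah 0) (atp 0)) (k : ℕ) : Inv (ah k) (atp k) := by
  induction k with
  | zero => exact h0
  | succ k ih =>
    obtain ⟨_, _, _, _, _, h, -⟩ := (hstep k).exists_move
    exact h.inv ih

theorem signal_mem_of_le
    (hstep : ∀ k, AnnoStep (t k) (σ k) (ah k) (atp k) (ah (k + 1)) (atp (k + 1)))
    {s : Signal U} {b k m} (hk : k ≤ m) (h : .signal s b ∈ ah k) : ∃ b', .signal s b' ∈ ah m := by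
  induction m, hk using Nat.le_induction with
  | base => exact ⟨b, h⟩
  | succ m _ ih =>
    obtain ⟨b', hb'⟩ := ih
    obtain ⟨_, _, _, _, _, h, -⟩ := (hstep m).exists_move
    exact h.spec.signals_mono _ _ hb'

/-- Steps never unset a signal, and one that already exists cannot be created again, since creation
needs an unused ID. -/
theorem unset_of_unset_later
    (hstep : ∀ k, AnnoStep (t k) (σ k) (ah k) (atp k) (ah (k + 1)) (atp (k + 1)))
    {s : Signal U} {b k m} (hk : k ≤ m) (h : .signal s b ∈ ah k) (hm : .signal s false ∈ ah m) :
    .signal s false ∈ ah k := by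
  induction m, hk using Nat.le_induction with
  | base => exact hm
  | succ m hkm ih =>
    apply ih
    obtain ⟨_, _, _, _, _, hmove, -⟩ := (hstep m).exists_move
    obtain ⟨b', hb'⟩ := signal_mem_of_le hstep hkm h
    rcases hmove.spec.signals with hs | ⟨s₀, hs₀, -, hs⟩
    · obtain ⟨b₁, hb₁, hb₂⟩ := hs _ _ hm
      exact hb₂ rfl ▸ hb₁
    · rcases hs _ _ hm with rfl | hs
      · exact absurd ⟨_, _, hb'⟩ hs₀
      · exact hs

theorem unset_of_wait
    (hstep : ∀ k, AnnoStep (t k) (σ k) (ah k) (atp k) (ah (k + 1)) (atp (k + 1)))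
    {s : Signal U} {k} (h : σ k = some s) : .signal s false ∈ ah k := by
  obtain ⟨_, _, _, _, _, hmove, -⟩ := (hstep k).exists_move
  exact hmove.spec.wait s h

/-- Signals persist, so both are present at the later of the two times, where IDs are unique. -/
theorem signal_eq_of_waits
    (hstep : ∀ k, AnnoStep (t k) (σ k) (ah k) (atp k) (ah (k + 1)) (atp (k + 1)))
    (h0 : Inv (ah 0) (atp 0)) {s s' : Signal U} {k m} (h : σ k = some s) (h' : σ m = some s')
    (he : s.1 = s'.1) : s = s' := by
  obtain ⟨b, hb⟩ := signal_mem_of_le hstep (le_max_left k m) (unset_of_wait hstep h)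
  obtain ⟨b', hb'⟩ := signal_mem_of_le hstep (le_max_right k m) (unset_of_wait hstep h')
  exact (inv_of_steps hstep h0 _).signal_unique _ _ _ _ hb hb' he

theorem exists_phases
    (hstep : ∀ k, AnnoStep (t k) (σ k) (ah k) (atp k) (ah (k + 1)) (atp (k + 1)))
    (h0 : Inv (ah 0) (atp 0)) : ∃ (ph : ℕ → PhaseID) (bg : ℕ → Bag (Ob U)), ∀ k,
      (∃ lh c, (atp k).lookup (t k) = some (lh, .run c) ∧ lh.Owns (ph k) (bg k)) ∧
      PermChange (ph k) (bg k) (σ k) (totalPerms (ah k) (atp k))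
        (totalPerms (ah (k + 1)) (atp (k + 1))) := by
  have (k : ℕ) : ∃ i O, (∃ lh c, (atp k).lookup (t k) = some (lh, .run c) ∧ lh.Owns i O) ∧
      PermChange i O (σ k) (totalPerms (ah k) (atp k))
        (totalPerms (ah (k + 1)) (atp (k + 1))) := by
    obtain ⟨lh, c, _, _, _, h, -⟩ := (hstep k).exists_move
    obtain ⟨i, O, hO⟩ := (inv_of_steps hstep h0 k).owns _ _ _ h.lookup
    exact ⟨i, O, ⟨lh, c, h.lookup, hO⟩, h.permChange hO⟩
  choose ph bg h using this
  exact ⟨ph, bg, h⟩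

/-- Otherwise permissions are consumed only finitely often in all phases together. After that the
total weight of the pool never grows and every real step lowers it, while fairness supplies real
steps forever. -/
theorem exists_infinite_waits
    (hstep : ∀ k, AnnoStep (t k) (σ k) (ah k) (atp k) (ah (k + 1)) (atp (k + 1)))
    (hfair : IsFair ah atp) (h0 : Inv (ah 0) (atp 0))
    (hB : ∃ B, totalPerms (ah 0) (atp 0) ≤ mult B) :
    ∃ s, {j | σ j = some s}.Infinite := by
  by_contra! hfin
  obtain ⟨ph, bg, hph⟩ := exists_phases hstep h0
  obtain ⟨K, -, hK⟩ := eventually_not_consumes (fun k => (hph k).2) hB (Φ := Set.univ)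
    (fun _ _ _ _ => trivial) 0 (fun id => by
      rcases Set.eq_empty_or_nonempty {j | 0 ≤ j ∧ ph j ∈ Set.univ ∧ ∃ s, σ j = some s ∧ s.1 = id}
        with he | ⟨j₀, -, -, s₀, hs₀, rfl⟩
      · rw [he]
        exact Set.finite_empty
      · refine (hfin s₀).subset ?_
        rintro j ⟨-, -, s, hs, he⟩
        exact signal_eq_of_waits hstep h0 hs hs₀ he ▸ hs)
  let W (k : ℕ) : ℕ := PoolOf.sum (fun x => x.2.weight) (atp k)
  have hW {k t σ lh c lh' T' N}
      (h : Move t σ (ah k) (atp k) (ah (k + 1)) (atp (k + 1)) lh c lh' T' N) :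
      W k = (Thread.run c).weight + (atp k).sumOthers (fun x => x.2.weight) t ∧
      W (k + 1) = T'.weight + N.elim 0 (fun n => n.2.weight) +
        (atp k).sumOthers (fun x => x.2.weight) t := by
    refine ⟨PoolOf.sum_eq _ h.lookup, ?_⟩
    simp only [W]
    rw [h.pool, PoolOf.sum_add, PoolOf.sum_insert]
    ring
  have hmono : ∀ k, K ≤ k → W (k + 1) ≤ W k := by
    intro k hk
    obtain ⟨lh, c, lh', T', N, h, hc | hw | ⟨rfl, rfl⟩⟩ := (hstep k).exists_move
    · obtain ⟨i, O, hO⟩ := (inv_of_steps hstep h0 k).owns _ _ _ h.lookup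
      exact absurd (hc i O hO) (hK k hk i trivial)
    · rw [(hW h).1, (hW h).2]
      exact Nat.add_le_add_right hw.le _
    · rw [(hW h).1, (hW h).2]
      simp
  have key (w : ℕ) : ∀ k, K ≤ k → W k ≤ w → False := by
    induction w using Nat.strong_induction_on with
    | _ w ih =>
      intro k hk hw
      -- The thread that performs step `k` is running, so fairness applies to it.
      obtain ⟨lh, c, hl, -⟩ := (hph k).1
      obtain ⟨n, hn, hreal⟩ := hfair k (t k) lh c hl
      have hKn := hk.trans hn
      have hle : W n ≤ W k := by
        clear hreal hKn
        induction n, hn using Nat.le_induction with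
        | base => exact le_rfl
        | succ n hkn ih => exact (hmono n (hk.trans hkn)).trans ih
      obtain ⟨lh, c, lh', T', N, h, hc | hlt⟩ := hreal.exists_move
      · obtain ⟨i, O, hO⟩ := (inv_of_steps hstep h0 n).owns _ _ _ h.lookup
        exact hK n hKn i trivial (hc i O hO)
      · have hlt : W (n + 1) < W n := by
          rw [(hW h).1, (hW h).2]
          exact Nat.add_lt_add_right hlt _
        exact ih _ (hlt.trans_le (hle.trans hw)) (n + 1) (hKn.trans (Nat.le_succ n)) le_rfl
  exact key _ K le_rfl le_rfl

/-- The size of the command of a thread. -/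
noncomputable def threadWeight (atp : AnnoPool.{u, v} U) (t : U.TID) : ℕ :=
  (atp.lookup t).elim 0 fun x => x.2.weight

/-- The obligation to set the signal `s` passes from one thread to the next in a step, which
consumes a permission, decreases the size of the holder, or is no real step of the holder. -/
theorem Holds.exists_next
    (hstep : ∀ k, AnnoStep (t k) (σ k) (ah k) (atp k) (ah (k + 1)) (atp (k + 1)))
    (h0 : Inv (ah 0) (atp 0)) {k s θ i} (hs : .signal s false ∈ ah (k + 1))
    (hθ : Holds (atp k) s θ i) :
    ∃ θ' i', Holds (atp (k + 1)) s θ' i' ∧ i <+: i' ∧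
      (Consumes i (totalPerms (ah k) (atp k)) (totalPerms (ah (k + 1)) (atp (k + 1))) ∨
        threadWeight (atp (k + 1)) θ' < threadWeight (atp k) θ ∨
        θ' = θ ∧ threadWeight (atp (k + 1)) θ' ≤ threadWeight (atp k) θ ∧
          ¬ RealStep θ (ah k) (atp k) (ah (k + 1)) (atp (k + 1))) := by
  have hlocks := (inv_of_steps hstep h0 k).locks
  obtain ⟨lh₁, c₁, O, hl, hO, hpos⟩ := id hθ
  -- Fairness only says that two consecutive configurations are related by a real step of `θ`,
  -- whatever step the sequence records there; hence the split on this relation and not on the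
  -- scheduled thread.
  by_cases hr : RealStep θ (ah k) (atp k) (ah (k + 1)) (atp (k + 1))
  · obtain ⟨lh, c, lh', T', N, h, hc⟩ := hr.exists_move
    obtain ⟨θ', i', hθ', hi, hw, -⟩ := h.exists_holds hlocks hs hθ
    rw [h.lookup] at hl
    cases hl
    refine ⟨θ', i', hθ', hi, hc.imp (fun hc => hc i O hO) fun hc => .inl (hw.trans_lt ?_)⟩
    simpa [threadWeight, h.lookup, WeightLt] using hc
  · obtain ⟨lh, c, lh', T', N, h, hc⟩ := (hstep k).exists_move
    by_cases hne : θ = t k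
    · subst hne
      obtain ⟨θ', i', hθ', hi, hw, hN⟩ := h.exists_holds hlocks hs hθ
      rw [h.lookup] at hl
      cases hl
      refine ⟨θ', i', hθ', hi, ?_⟩
      rcases hc with hc | hc | ⟨rfl, rfl⟩
      · exact .inl (hc i O hO)
      · refine .inr (.inl (hw.trans_lt ?_))
        simpa [threadWeight, h.lookup, WeightLt] using hc
      · refine .inr (.inr ⟨hN rfl, hw.trans (le_of_eq ?_), hr⟩)
        simp [threadWeight, h.lookup]
    · have hl' := h.lookup_of_ne hne hl
      refine ⟨θ, i, ⟨_, _, O, hl', hO, hpos⟩, List.prefix_rfl, .inr (.inr ⟨rfl, ?_, hr⟩)⟩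
      simp [threadWeight, hl, hl']

/-- The holders of the obligation for `s` are followed through time. Waits in their phases concern
only lower signals, hence they eventually consume nothing, and each real step of the holder then
lowers its weight. -/
theorem not_infinite_waits
    (hstep : ∀ k, AnnoStep (t k) (σ k) (ah k) (atp k) (ah (k + 1)) (atp (k + 1)))
    (hfair : IsFair ah atp) (h0 : Inv (ah 0) (atp 0))
    (hB : ∃ B, totalPerms (ah 0) (atp 0) ≤ mult B) (s : Signal U)
    (hinf : {j | σ j = some s}.Infinite)
    (hmin : ∀ s', {j | σ j = some s'}.Infinite → ¬ s'.2 < s.2) : False := by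
  obtain ⟨k₀, hk₀⟩ := hinf.nonempty
  have hunset (k : ℕ) (hk : k₀ ≤ k) : .signal s false ∈ ah k := by
    obtain ⟨m, hm, hkm⟩ := hinf.exists_gt k
    obtain ⟨b, hb⟩ := signal_mem_of_le hstep hk (unset_of_wait hstep hk₀)
    exact unset_of_unset_later hstep hkm.le hb (unset_of_wait hstep hm)
  obtain ⟨f, hf⟩ := exists_chain (α := U.TID × PhaseID)
    (fun n a => Holds (atp (k₀ + n)) s a.1 a.2)
    (fun n a b => a.2 <+: b.2 ∧
      (Consumes a.2 (totalPerms (ah (k₀ + n)) (atp (k₀ + n)))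
          (totalPerms (ah (k₀ + n + 1)) (atp (k₀ + n + 1))) ∨
        threadWeight (atp (k₀ + n + 1)) b.1 < threadWeight (atp (k₀ + n)) a.1 ∨
        b.1 = a.1 ∧ threadWeight (atp (k₀ + n + 1)) b.1 ≤ threadWeight (atp (k₀ + n)) a.1 ∧
          ¬ RealStep a.1 (ah (k₀ + n)) (atp (k₀ + n)) (ah (k₀ + n + 1)) (atp (k₀ + n + 1))))
    (by
      obtain ⟨θ, i, h⟩ := (inv_of_steps hstep h0 k₀).holds s (hunset k₀ le_rfl)
      exact ⟨(θ, i), h⟩)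
    (fun n a ha => by
      obtain ⟨θ', i', h, h'⟩ := ha.exists_next hstep h0 (hunset _ (by omega))
      exact ⟨(θ', i'), h, h'⟩)
  have hpre {m n : ℕ} (h : m ≤ n) : (f m).2 <+: (f n).2 := by
    induction n, h using Nat.le_induction with
    | base => exact List.prefix_rfl
    | succ n _ ih => exact ih.trans (hf n).2.1
  obtain ⟨ph, bg, hph⟩ := exists_phases hstep h0
  obtain ⟨K, hkK, hK⟩ := eventually_not_consumes (fun k => (hph k).2) hB
    (Φ := {i | ∃ n, i <+: (f n).2}) (fun i j hij ⟨n, hn⟩ => ⟨n, hij.trans hn⟩) k₀ (fun id => by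
      rcases Set.eq_empty_or_nonempty {j | k₀ ≤ j ∧ ph j ∈ {i | ∃ n, i <+: (f n).2} ∧
          ∃ s, σ j = some s ∧ s.1 = id} with he | ⟨j, hj, ⟨m, hm⟩, s₀, hs₀, rfl⟩
      · rw [he]
        exact Set.finite_empty
      · obtain ⟨n, rfl⟩ := Nat.exists_eq_add_of_le hj
        obtain ⟨lh, c, O, hl, hO, hpos⟩ := (hf n).1
        obtain ⟨⟨lh', c', hl', hO'⟩, hperm⟩ := hph (k₀ + n)
        -- The waiting phase and the phase of the current holder are both prefixes of a later phase
        -- of the chain, hence comparable, which for distinct threads is impossible.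
        have ht : (f n).1 = t (k₀ + n) := by
          by_contra hne
          have hinc := (inv_of_steps hstep h0 (k₀ + n)).incomparable
          rcases List.prefix_or_prefix_of_prefix (hm.trans (hpre (le_max_left m n)))
            (hpre (le_max_right m n)) with h | h
          · exact hinc _ _ _ _ _ _ _ _ (Ne.symm hne) hl' hl hO' hO h
          · exact hinc _ _ _ _ _ _ _ _ hne hl hl' hO hO' h
        rw [ht, hl'] at hl
        cases hl
        obtain ⟨-, rfl⟩ := hO.unique hO'
        have hlt : s₀.2 < s.2 := by
          rw [hs₀] at hperm
          cases hperm with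
          | wait _ _ _ _ hlevel => exact hlevel _ hpos
        refine (Set.not_infinite.1 fun h => hmin s₀ h hlt).subset ?_
        rintro j ⟨-, -, s', hs', he⟩
        exact signal_eq_of_waits hstep h0 hs' hs₀ he ▸ hs')
  obtain ⟨n₀, rfl⟩ := Nat.exists_eq_add_of_le hkK
  have hdec (n : ℕ) (hn : n₀ ≤ n) :=
    (hf n).2.2.resolve_left (hK (k₀ + n) (by omega) _ ⟨n, List.prefix_rfl⟩)
  have key (w : ℕ) : ∀ n, n₀ ≤ n → threadWeight (atp (k₀ + n)) (f n).1 ≤ w → False := by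
    induction w using Nat.strong_induction_on with
    | _ w ih =>
      intro n hn hw
      -- As long as the weight of the holder does not drop, the holder stays the same and makes no
      -- real step; fairness refutes this forever.
      have hconst (m : ℕ) (hm : n ≤ m) : (f m).1 = (f n).1 ∧
          threadWeight (atp (k₀ + m)) (f m).1 ≤ w := by
        induction m, hm using Nat.le_induction with
        | base => exact ⟨rfl, hw⟩
        | succ m hm ihm =>
          rcases hdec m (hn.trans hm) with h | ⟨h₁, h₂, -⟩
          · exact (ih _ (h.trans_le ihm.2) (m + 1) (by omega) le_rfl).elim
          · exact ⟨h₁.trans ihm.1, h₂.trans ihm.2⟩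
      obtain ⟨lh, c, O, hl, -⟩ := (hf n).1
      obtain ⟨m, hm, hreal⟩ := hfair _ _ _ _ hl
      obtain ⟨m, rfl⟩ := Nat.exists_eq_add_of_le (show k₀ ≤ m by omega)
      have hnm : n ≤ m := by omega
      obtain ⟨h₁, h₂⟩ := hconst m hnm
      rcases hdec m (hn.trans hnm) with h | ⟨-, -, h⟩
      · exact ih _ (h.trans_le h₂) (m + 1) (by omega) le_rfl
      · exact h (h₁ ▸ hreal)
  exact key _ n₀ le_rfl le_rfl

end

end
end GhostSignals

theorem mainTheorem3 (U : BaseSets.{u}) (c : Cmd U) (i₀ : PhaseID) (n : ℕ) (d : Fin n → U.Degree)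
    (hc : HoareModels (initialAssertion.{u, v} i₀ d) c fun _ => .obs 0)
    (t₀ : U.TID) (lh₀ : LogHeap.{u, v} U)
    (hlh₀ : lh₀ = LogHeap.ofSet (initialResources i₀ d) ∨
      lh₀ = LogHeap.ofMultiset (initialResources i₀ d)) :
    ¬ ∃ (ah : ℕ → AnnoHeap.{u, v} U) (atp : ℕ → AnnoPool.{u, v} U) (σ : ℕ → Option (Signal U)),
      IsAnnoRedSeq ah atp σ ∧ IsFair ah atp ∧
      ah 0 = ∅ ∧ atp 0 = Finmap.singleton t₀ (lh₀, .run c) := by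
  rintro ⟨ah, atp, σ, ⟨t, hstep⟩, hfair, hah, hatp⟩
  have howns : lh₀.Owns i₀ 0 := by
    rcases hlh₀ with rfl | rfl
    · exact owns_ofSet_initialResources i₀ d
    · exact owns_ofMultiset_initialResources i₀ d
  have h0 : Inv (ah 0) (atp 0) := by
    rw [hah, hatp]
    exact .initial t₀ howns _
  have hB : ∃ B, totalPerms (ah 0) (atp 0) ≤ mult B := by
    obtain ⟨B, hB⟩ := LogHeap.exists_perms_ofMultiset_le (initialResources.{u, v} i₀ d)
    refine ⟨B, le_trans (le_trans (le_of_eq ?_) (LogHeap.perms_mono (?_ : lh₀ ≤ _))) hB⟩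
    · rw [hah, hatp, totalPerms, PoolOf.sum, Finmap.keys_singleton, Finset.sum_singleton,
        Finmap.lookup_singleton_eq]
      simp [AnnoHeap.protectedHeap]
    · rcases hlh₀ with rfl | rfl
      · exact LogHeap.ofSet_le_ofMultiset _
      · exact le_rfl
  -- Well-foundedness of the levels yields a signal of minimal level among those waited for
  -- infinitely often.
  obtain ⟨s, hs, hmin⟩ := (InvImage.wf Prod.snd (wellFounded_lt (α := U.Level))).has_min
    {s : Signal U | {j | σ j = some s}.Infinite} (exists_infinite_waits hstep hfair h0 hB)
  exact not_infinite_waits hstep hfair h0 hB s hs hmin
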